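/- **Notation.** A subpartition of a partition $\lambda=(\lambda_1\ge\dots\ge\lambda_k)$ is a partition $\nu=(\nu_1\ge\dots\ge\nu_\ell)$ with $\ell\le k$ and $\nu_i\le\lambda_i$ for all $i\le \ell$; let $s(\lambda)$ be the number of subpartitions of $\lambda$. Let $\Lambda(t)=\log \mathbb E[e^{tS_1}]$, where $S_1=\pm1$ with probability $\tfrac12$ each, let $\Lambda^*(p)=\sup_{t\in\mathbb R}(tp-\Lambda(t))$ be its Legendre transform and $\phi=\log 2-\Lambda^*$ on $[-1,1]$. Let $\mathcal X$ be the set of all $1$-Lipschitz functions $f:\mathbb R\to\mathbb R$ with $f(x)\ge|x|$ for all $x$ and $\int_{\mathbb R}(f(x)-|x|)\,dx\le 1$, and put $F(f)=\int_{\mathbb R}\phi(f'(x))\,dx$. For a partition $\lambda$ of $n\ge1$ let $g_\lambda$ be its profile in the Russian convention (the Young diagram with unit boxes is rotated by $135^\circ$ and placed on the graph of $|x|$; $g_\lambda$ is the upper boundary), let $f_\lambda(x)=n^{-1/2}g_\lambda(n^{1/2}x)$, and let $h_\lambda$ be the lower convex envelope of $f_\lambda$, i.e. the supremum of all convex functions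 that are at most $f_\lambda$. **Proposition.** The integral defining $F(f)$ converges for every $f\in\mathcal X$, and $F$ attains a maximum $M(F)=\max_{\mathcal X}F$ on $\mathcal X$. There is a sequence of partitions $\mu_n$ of $n$ such that the number of subpartitions of $\mu_n$ grows as $$s(\mu_n)=e^{\sqrt{2n}\,M(F)-o(\sqrt n)}\qquad (n\to\infty).$$ Moreover, for this sequence the upper bound $e^{\sqrt{2n}\,F(h_\lambda)}$ for $s(\lambda)$, given by the lower convex envelope, is sharp on the exponential scale: $$s(\mu_n)=e^{\sqrt{2n}\,F(h_{\mu_n})-o(\sqrt n)}\qquad (n\to\infty).$$ -/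

import Mathlib

open MeasureTheory ProbabilityTheory Filter Asymptotics

namespace SubpartitionGrowth

noncomputable section

/-! ### Partitions and subpartitions -/

/-- The parts of a partition in weakly decreasing order, `lam₁ ≥ lam₂ ≥ … ≥ lam_k > 0`;
`row lam i` is `lam_{i+1}`, and it is `0` when `i ≥ k`. -/
def row {n : ℕ} (lam : n.Partition) (i : ℕ) : ℕ :=
  (lam.parts.sort (fun a b => b ≤ a)).getD i 0

/-- `nu = (nu₁ ≥ … ≥ nu_l)` is a subpartition of `lam = (lam₁ ≥ … ≥ lam_k)` if `l ≤ k` and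
`nu_i ≤ lam_i` for all `i ≤ l`. The partition `nu` may have any size `m`. -/
def IsSubpartition {m n : ℕ} (nu : m.Partition) (lam : n.Partition) : Prop :=
  Multiset.card nu.parts ≤ Multiset.card lam.parts ∧
    ∀ i < Multiset.card nu.parts, row nu i ≤ row lam i

/-- The number of subpartitions of `lam` (of all sizes, including the empty one and `lam`). -/
def numSubpartitions {n : ℕ} (lam : n.Partition) : ℕ :=
  Set.ncard {nu : (m : ℕ) × m.Partition | IsSubpartition nu.2 lam}

/-! ### The profile of a partition in the Russian convention -/

/-- The profile `g_lam`: the `(i, j)`-th unit box of the English diagram (row `i`, column `j`,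
counted from `0`) is the set of points at horizontal distance `a ∈ [j, j + 1]` and vertical
distance `b ∈ [i, i + 1]` from the corner; rotating by `135` degrees takes such a point to
`((b - a) / √2, (a + b) / √2)`. The value `g_lam x` is the largest height of a point above `x`
in the rotated diagram or on the graph of `|x|`. -/
def profile {n : ℕ} (lam : n.Partition) (x : ℝ) : ℝ :=
  sSup ({|x|} ∪ {y : ℝ | ∃ i j : ℕ, j < row lam i ∧
    ∃ a ∈ Set.Icc (j : ℝ) (j + 1), ∃ b ∈ Set.Icc (i : ℝ) (i + 1),
      x = (b - a) / √2 ∧ y = (a + b) / √2})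

/-- The rescaled profile `f_lam x = n^{-1/2} g_lam (n^{1/2} x)` of a partition of `n`. -/
def scaledProfile {n : ℕ} (lam : n.Partition) (x : ℝ) : ℝ :=
  (√(n : ℝ))⁻¹ * profile lam (√(n : ℝ) * x)

/-- The lower convex envelope of `f`: the supremum of all convex functions that are at
most `f`. -/
def lowerConvexEnvelope (f : ℝ → ℝ) (x : ℝ) : ℝ :=
  sSup {y : ℝ | ∃ g : ℝ → ℝ, ConvexOn ℝ Set.univ g ∧ (∀ z, g z ≤ f z) ∧ y = g x}

/-! ### The functional -/

/-- The law of the first step `S₁` of the simple symmetric random walk on `ℤ`. -/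
def stepLaw : Measure ℝ :=
  (2⁻¹ : ENNReal) • Measure.dirac 1 + (2⁻¹ : ENNReal) • Measure.dirac (-1)

/-- `Λ t = log E[exp (t S₁)]`. -/
def logMgf (t : ℝ) : ℝ := cgf id stepLaw t

/-- The Legendre transform `Λ* p = sup_t (t p - Λ t)`. It is only used for `p ∈ [-1, 1]`, where
the supremum is finite. -/
def rate (p : ℝ) : ℝ := ⨆ t : ℝ, (t * p - logMgf t)

/-- `φ = log 2 - Λ*`, used on `[-1, 1]`. -/
def phi (p : ℝ) : ℝ := Real.log 2 - rate p

/-- The space `𝒳` of `1`-Lipschitz functions `f` with `f x ≥ |x|` and `∫ (f x - |x|) dx ≤ 1`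
(the integral of a nonnegative function; in particular it is finite). -/
def spaceX : Set (ℝ → ℝ) :=
  {f | LipschitzWith 1 f ∧ (∀ x, |x| ≤ f x) ∧
    Integrable (fun x => f x - |x|) ∧ ∫ x, (f x - |x|) ≤ 1}

/-- The functional `F h = ∫ φ (h' x) dx`; a Lipschitz `h` is differentiable almost everywhere. -/
def functionalF (h : ℝ → ℝ) : ℝ := ∫ x, phi (deriv h x)

end

end SubpartitionGrowth

namespace SubpartitionGrowth

/-! ### The rate function and the binary entropy -/

/-! On `[-1, 1]` the function φ is the binary entropy of `(1 + p) / 2`, so Gibbs' inequality gives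
`φ p ≤ t (1 - p) + log (1 + exp (-2t))`, with equality at `p = tanh t`. Put `t = c x` and integrate
over `x > 0`. Integration by parts turns the linear term into at most `c` times the area between `f`
and `|x|`, and the logarithmic term integrates to `π² / (24 c)`. For `c = π / (2√3)` this equals `c
/ 2`. The two half-lines together give `F f ≤ 2c`, and `log (2 cosh (c x)) / c`, which has slope
`tanh (c x)` and area exactly 1, attains it. Hence `M(F) = 2c = π / √3`.

The exponent `√(2n) M(F) = π √(2n/3)` is the Hardy-Ramanujan exponent. The upper bound for `s(μ_n)`
therefore needs only the size of the partition: Euler's product bounds the number of all partitions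
of size at most `n` (`numSubpartitions_le_exp`).

For the lower bound, `μ_n` follows the curve `exp (-t a) + exp (-t b) = 1` with `t = π / √(6n)`,
which is the maximiser in rotated coordinates (`height_le_iff`). Its rows are cut into blocks, and
inside each block the boundary of a subpartition is a free lattice path in a rectangle
(`prod_choose_le_numSubpartitions`). Convex duality between binomial entropy and `ell y = -log (1 -
exp (-y))` bounds the product of binomial coefficients below by `exp ((2 ∫ ell - o(1)) / t)`, and `∫
ell = ζ(2)` makes the two bounds meet.

For the envelope statement, `h_{μ_n}` belongs to `𝒳` and lies within `O(n^{-1/2})` of the maximiser.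
Convexity upgrades this to convergence of derivatives, and Fatou's lemma with the maximality of
`M(F)` gives `F(h_{μ_n}) → M(F)`. -/

theorem logMgf_eq (t : ℝ) :
    logMgf t = t + Real.log (1 + Real.exp (-2 * t)) - Real.log 2 := by
  have h : mgf id stepLaw t = Real.exp t * (1 + Real.exp (-2 * t)) / 2 := by
    have hint : ∀ a : ℝ, Integrable (fun x : ℝ => Real.exp (t * id x))
        ((2⁻¹ : ENNReal) • Measure.dirac a) := fun a =>
      (integrable_dirac (by simp)).smul_measure (by simp)
    rw [mgf, stepLaw, integral_add_measure (hint 1) (hint (-1)), integral_smul_measure,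
      integral_smul_measure, integral_dirac, integral_dirac, mul_add, ← Real.exp_add]
    simp only [id, ENNReal.toReal_inv, ENNReal.toReal_ofNat, smul_eq_mul]
    ring_nf
  rw [logMgf, cgf, h, Real.log_div (by positivity) (by norm_num),
    Real.log_mul (by positivity) (by positivity), Real.log_exp]

/-- Gibbs' inequality for the binary entropy. -/
theorem binEntropy_le_tilt {p : ℝ} (h1 : -1 ≤ p) (h2 : p ≤ 1) (t : ℝ) :
    Real.binEntropy ((1 + p) / 2) ≤ t * (1 - p) + Real.log (1 + Real.exp (-2 * t)) := by
  set q := (1 + p) / 2 with hq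
  set Z := 1 + Real.exp (-2 * t) with hZ
  have hZ0 : 0 < Z := by positivity
  have key : ∀ x y : ℝ, 0 ≤ x → 0 < y → x * Real.log x⁻¹ + x * Real.log y ≤ y - x := by
    intro x y hx hy
    rcases hx.eq_or_lt with rfl | hx
    · simpa using hy.le
    · rw [← mul_add, ← Real.log_mul (by positivity) hy.ne']
      have := Real.log_le_sub_one_of_pos (show 0 < x⁻¹ * y by positivity)
      have h3 := mul_le_mul_of_nonneg_left this hx.le
      rw [mul_sub, ← mul_assoc, mul_inv_cancel₀ hx.ne'] at h3
      linarith
  -- The comparison law is the tilted step law with weights `1 / Z` and `exp (-2t) / Z`. Both laws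
  -- have mass one, so the right-hand sides of `k1` and `k2` add up to zero.
  have k1 := key q (1 / Z) (by rw [hq]; linarith) (by positivity)
  have k2 := key (1 - q) (Real.exp (-2 * t) / Z) (by rw [hq]; linarith) (by positivity)
  rw [Real.log_div one_ne_zero hZ0.ne', Real.log_one] at k1
  rw [Real.log_div (Real.exp_pos _).ne' hZ0.ne', Real.log_exp] at k2
  have hs : 1 / Z + Real.exp (-2 * t) / Z = 1 := by
    rw [← add_div, ← hZ, div_self hZ0.ne']
  have hp : p = 2 * q - 1 := by rw [hq]; ring
  rw [Real.binEntropy, hp]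
  nlinarith

/-- The equality case of Gibbs' inequality: `(1 + tanh t) / 2 = 1 / Z` is the tilted law itself. -/
theorem binEntropy_tanh (t : ℝ) :
    Real.binEntropy ((1 + Real.tanh t) / 2) =
      t * (1 - Real.tanh t) + Real.log (1 + Real.exp (-2 * t)) := by
  set Z := 1 + Real.exp (-2 * t) with hZ
  have hZ0 : 0 < Z := by positivity
  have he : Real.exp (-2 * t) = Real.exp (-t) / Real.exp t := by
    rw [← Real.exp_sub]; ring_nf
  have hq : (1 + Real.tanh t) / 2 = 1 / Z := by
    rw [Real.tanh_eq, hZ, he]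
    field_simp
    ring
  have hq' : 1 - 1 / Z = Real.exp (-2 * t) / Z := by
    rw [hZ] at hZ0 ⊢; field_simp; ring
  have htanh : 1 - Real.tanh t = 2 * (Real.exp (-2 * t) / Z) := by
    rw [← hq', ← hq]; ring
  rw [htanh, Real.binEntropy, hq, hq', Real.log_inv, Real.log_inv,
    Real.log_div one_ne_zero hZ0.ne', Real.log_one,
    Real.log_div (Real.exp_pos _).ne' hZ0.ne', Real.log_exp]
  have hs : 1 / Z + Real.exp (-2 * t) / Z = 1 := by
    rw [← add_div, ← hZ, div_self hZ0.ne']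
  linear_combination (Real.log Z) * hs

/-- For `|p| < 1` the supremum is attained at `t = artanh p`. At `p = ±1` it is only approached as
`t → ±∞`, so the endpoints need a limit. -/
theorem rate_eq {p : ℝ} (h1 : -1 ≤ p) (h2 : p ≤ 1) :
    rate p = Real.log 2 - Real.binEntropy ((1 + p) / 2) := by
  have hle : ∀ t : ℝ, t * p - logMgf t ≤ Real.log 2 - Real.binEntropy ((1 + p) / 2) := by
    intro t
    have := binEntropy_le_tilt h1 h2 t
    rw [logMgf_eq]
    linarith
  have hbdd : BddAbove (Set.range fun t : ℝ => t * p - logMgf t) :=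
    ⟨_, by rintro _ ⟨t, rfl⟩; exact hle t⟩
  have hlim : Tendsto (fun t : ℝ => Real.log 2 - Real.log (1 + Real.exp (-2 * t))) atTop
      (nhds (Real.log 2)) := by
    have h0 : Tendsto (fun t : ℝ => Real.exp (-2 * t)) atTop (nhds 0) :=
      Real.tendsto_exp_atBot.comp (tendsto_id.const_mul_atTop_of_neg (by norm_num))
    have : Tendsto (fun t : ℝ => Real.log (1 + Real.exp (-2 * t))) atTop
        (nhds (Real.log (1 + 0))) := (h0.const_add 1).log (by norm_num)
    simpa using this.const_sub (Real.log 2)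
  refine le_antisymm (ciSup_le hle) ?_
  rcases h2.eq_or_lt with rfl | h2
  · have : Real.log 2 - Real.binEntropy ((1 + 1) / 2) = Real.log 2 := by norm_num
    rw [this]
    refine le_of_tendsto hlim (Eventually.of_forall fun t => ?_)
    refine le_trans (le_of_eq ?_) (le_ciSup hbdd t)
    simp only [logMgf_eq]; ring
  rcases h1.eq_or_lt with rfl | h1
  · have : Real.log 2 - Real.binEntropy ((1 + -1) / 2) = Real.log 2 := by norm_num
    rw [this]
    refine le_of_tendsto hlim (Eventually.of_forall fun t => ?_)
    refine le_trans (le_of_eq ?_) (le_ciSup hbdd (-t))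
    simp only [logMgf_eq]
    have : 1 + Real.exp (-2 * -t) = Real.exp (2 * t) * (1 + Real.exp (-2 * t)) := by
      rw [mul_add, ← Real.exp_add]; ring_nf; simp; ring
    rw [this, Real.log_mul (by positivity) (by positivity), Real.log_exp]
    ring
  · obtain ⟨t, rfl⟩ : ∃ t, Real.tanh t = p := ⟨Real.artanh p, Real.tanh_artanh ⟨h1, h2⟩⟩
    refine le_trans (le_of_eq ?_) (le_ciSup hbdd t)
    simp only [logMgf_eq, binEntropy_tanh]
    ring

theorem phi_eq_binEntropy {p : ℝ} (h1 : -1 ≤ p) (h2 : p ≤ 1) :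
    phi p = Real.binEntropy ((1 + p) / 2) := by
  rw [phi, rate_eq h1 h2]; ring

theorem phi_nonneg {p : ℝ} (h1 : -1 ≤ p) (h2 : p ≤ 1) : 0 ≤ phi p := by
  rw [phi_eq_binEntropy h1 h2]
  exact Real.binEntropy_nonneg (by linarith) (by linarith)

theorem phi_le_tilt {p : ℝ} (h1 : -1 ≤ p) (h2 : p ≤ 1) (t : ℝ) :
    phi p ≤ t * (1 - p) + Real.log (1 + Real.exp (-2 * t)) := by
  rw [phi_eq_binEntropy h1 h2]
  exact binEntropy_le_tilt h1 h2 t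

theorem abs_tanh_le_one (t : ℝ) : -1 ≤ Real.tanh t ∧ Real.tanh t ≤ 1 :=
  ⟨(Real.neg_one_lt_tanh t).le, (Real.tanh_lt_one t).le⟩

theorem phi_tanh (t : ℝ) :
    phi (Real.tanh t) = t * (1 - Real.tanh t) + Real.log (1 + Real.exp (-2 * t)) := by
  rw [phi_eq_binEntropy (abs_tanh_le_one t).1 (abs_tanh_le_one t).2, binEntropy_tanh]

theorem phi_neg (p : ℝ) (h1 : -1 ≤ p) (h2 : p ≤ 1) : phi (-p) = phi p := by
  rw [phi_eq_binEntropy h1 h2, phi_eq_binEntropy (by linarith) (by linarith),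
    ← Real.binEntropy_one_sub]
  ring_nf

/-! ### The function `-log (1 - exp (-y))` -/

/-- The logarithm of the generating function of the multiplicity of a single part. -/
noncomputable def ell (y : ℝ) : ℝ := -Real.log (1 - Real.exp (-y))

theorem one_sub_exp_neg_pos {y : ℝ} (hy : 0 < y) : 0 < 1 - Real.exp (-y) := by
  have : Real.exp (-y) < 1 := Real.exp_lt_one_iff.2 (by linarith)
  linarith

theorem ell_nonneg {y : ℝ} (hy : 0 < y) : 0 ≤ ell y := by
  have := Real.log_nonpos (one_sub_exp_neg_pos hy).le (by linarith [Real.exp_pos (-y)])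
  rw [ell]; linarith

theorem ell_anti {x y : ℝ} (hx : 0 < x) (hxy : x ≤ y) : ell y ≤ ell x := by
  rw [ell, ell, neg_le_neg_iff]
  refine Real.log_le_log (one_sub_exp_neg_pos hx) ?_
  have := Real.exp_le_exp.2 (neg_le_neg hxy)
  linarith

theorem convexOn_ell : ConvexOn ℝ (Set.Ioi 0) ell := by
  refine ⟨convex_Ioi 0, fun x hx y hy a b ha hb hab => ?_⟩
  have hx' := one_sub_exp_neg_pos hx
  have hy' := one_sub_exp_neg_pos hy
  have h1 := strictConcaveOn_log_Ioi.concaveOn.2 hx' hy' ha hb hab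
  have h2 := convexOn_exp.2 (Set.mem_univ (-x)) (Set.mem_univ (-y)) ha hb hab
  simp only [smul_eq_mul] at h1 h2 ⊢
  have h3 : Real.log (a * (1 - Real.exp (-x)) + b * (1 - Real.exp (-y))) ≤
      Real.log (1 - Real.exp (-(a * x + b * y))) := by
    refine Real.log_le_log ?_ ?_
    · rcases ha.eq_or_lt with rfl | ha
      · have : b = 1 := by linarith
        subst this; simpa using hy'
      · have := mul_pos ha hx'
        have := mul_nonneg hb hy'.le
        linarith
    · have : a * -x + b * -y = -(a * x + b * y) := by ring
      rw [this] at h2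
      linarith
  rw [ell, ell, ell]
  linarith

theorem continuousOn_ell : ContinuousOn ell (Set.Ioi 0) := by
  refine (ContinuousOn.log (by fun_prop) fun x hx => ?_).neg
  exact (one_sub_exp_neg_pos hx).ne'

theorem ell_le {y : ℝ} (hy : 0 < y) : ell y ≤ 1 / (Real.exp y - 1) := by
  have h := one_sub_exp_neg_pos hy
  have h1 := Real.one_sub_inv_le_log_of_pos h
  have h2 : (1 - Real.exp (-y))⁻¹ - 1 = 1 / (Real.exp y - 1) := by
    have he : 0 < Real.exp y - 1 := by linarith [Real.add_one_le_exp y]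
    rw [Real.exp_neg] at h ⊢
    field_simp
    ring
  rw [ell]; linarith

theorem hasSum_ell {y : ℝ} (hy : 0 < y) :
    HasSum (fun j : ℕ => Real.exp (-((j : ℝ) + 1) * y) / ((j : ℝ) + 1)) (ell y) := by
  have h := Real.hasSum_pow_div_log_of_abs_lt_one (x := Real.exp (-y))
    (by rw [abs_of_pos (Real.exp_pos _)]; exact Real.exp_lt_one_iff.2 (by linarith))
  rw [ell]
  convert h using 3 with j
  rw [← Real.exp_nat_mul]
  push_cast
  ring_nf

theorem hasSum_inv_succ_sq :
    HasSum (fun j : ℕ => 1 / ((j : ℝ) + 1) ^ 2) (Real.pi ^ 2 / 6) := by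
  have := (hasSum_nat_add_iff' 1).2 hasSum_zeta_two
  simpa using this

/-- Termwise integration of the expansion of the logarithm leaves `ζ(2)`. -/
theorem integral_ell : ∫ y in Set.Ioi (0 : ℝ), ell y = Real.pi ^ 2 / 6 := by
  have hj : ∀ j : ℕ, -((j : ℝ) + 1) < 0 := fun j => by
    have : (0 : ℝ) ≤ j := j.cast_nonneg
    linarith
  have hint : ∀ j : ℕ, ∫ y in Set.Ioi (0 : ℝ),
      Real.exp (-((j : ℝ) + 1) * y) / ((j : ℝ) + 1) = 1 / ((j : ℝ) + 1) ^ 2 := by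
    intro j
    rw [integral_div, integral_exp_mul_Ioi (hj j)]
    have h1 : (j : ℝ) + 1 ≠ 0 := by positivity
    rw [mul_zero, Real.exp_zero]
    field_simp
  have h := hasSum_integral_of_summable_integral_norm
    (μ := volume.restrict (Set.Ioi (0 : ℝ)))
    (F := fun (j : ℕ) (y : ℝ) => Real.exp (-((j : ℝ) + 1) * y) / ((j : ℝ) + 1))
    (fun j => (integrableOn_exp_mul_Ioi (hj j) 0).div_const _) (by
      have : ∀ j : ℕ, ∫ y in Set.Ioi (0 : ℝ),
          ‖Real.exp (-((j : ℝ) + 1) * y) / ((j : ℝ) + 1)‖ = 1 / ((j : ℝ) + 1) ^ 2 := by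
        intro j
        rw [← hint j]
        refine integral_congr_ae (Eventually.of_forall fun y => ?_)
        exact Real.norm_of_nonneg (by positivity)
      simp only [this]
      exact hasSum_inv_succ_sq.summable)
  simp only [hint] at h
  rw [h.unique hasSum_inv_succ_sq |>.symm]
  refine setIntegral_congr_fun measurableSet_Ioi fun y hy => ?_
  exact (hasSum_ell hy).tsum_eq.symm

theorem integrableOn_ell : IntegrableOn ell (Set.Ioi 0) := by
  -- A non-integrable function has Bochner integral zero, but the value `π² / 6` is positive.
  by_contra h
  have := integral_ell
  rw [integral_undef h] at this
  have := Real.pi_pos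
  have : 0 < Real.pi ^ 2 / 6 := by positivity
  linarith

theorem log_one_add_exp_neg {y : ℝ} (hy : 0 < y) :
    Real.log (1 + Real.exp (-y)) = ell y - ell (2 * y) := by
  have h := one_sub_exp_neg_pos hy
  have : 1 - Real.exp (-(2 * y)) = (1 - Real.exp (-y)) * (1 + Real.exp (-y)) := by
    have : Real.exp (-(2 * y)) = Real.exp (-y) * Real.exp (-y) := by
      rw [← Real.exp_add]; ring_nf
    rw [this]; ring
  rw [ell, ell, this, Real.log_mul h.ne' (by positivity)]
  ring

theorem integrableOn_ell_two_mul : IntegrableOn (fun y => ell (2 * y)) (Set.Ioi 0) := by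
  rw [integrableOn_Ioi_comp_mul_left_iff ell 0 (by norm_num : (0 : ℝ) < 2)]
  simpa using integrableOn_ell

theorem integrableOn_log_one_add_exp_neg :
    IntegrableOn (fun y => Real.log (1 + Real.exp (-y))) (Set.Ioi 0) :=
  (integrableOn_ell.sub integrableOn_ell_two_mul).congr_fun
    (fun _ hy => (log_one_add_exp_neg hy).symm) measurableSet_Ioi

theorem integral_log_one_add_exp_neg :
    ∫ y in Set.Ioi (0 : ℝ), Real.log (1 + Real.exp (-y)) = Real.pi ^ 2 / 12 := by
  rw [setIntegral_congr_fun measurableSet_Ioi fun y hy => log_one_add_exp_neg hy,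
    integral_sub integrableOn_ell integrableOn_ell_two_mul,
    integral_comp_mul_left_Ioi ell 0 (by norm_num : (0 : ℝ) < 2)]
  simp only [mul_zero, integral_ell, smul_eq_mul]
  ring

/-- Expand `ell` and sum over `k` first: each geometric sum is at most `1 / ((j + 1) t)`, since `exp
s - 1 ≥ s`, and `ζ(2) / t` remains. The bound serves both Euler's product and the size of the
optimal diagram. -/
theorem sum_ell_le {t : ℝ} (ht : 0 < t) (N : ℕ) :
    ∑ k ∈ Finset.range N, ell (t * ((k : ℝ) + 1)) ≤ Real.pi ^ 2 / (6 * t) := by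
  have h1 : HasSum (fun j : ℕ => ∑ k ∈ Finset.range N,
      Real.exp (-((j : ℝ) + 1) * (t * ((k : ℝ) + 1))) / ((j : ℝ) + 1))
      (∑ k ∈ Finset.range N, ell (t * ((k : ℝ) + 1))) :=
    hasSum_sum fun k _ => hasSum_ell (by positivity)
  have h2 : HasSum (fun j : ℕ => (1 / t) * (1 / ((j : ℝ) + 1) ^ 2))
      ((1 / t) * (Real.pi ^ 2 / 6)) := hasSum_inv_succ_sq.mul_left _
  have : Real.pi ^ 2 / (6 * t) = (1 / t) * (Real.pi ^ 2 / 6) := by field_simp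
  rw [this]
  refine hasSum_le (fun j => ?_) h1 h2
  set s : ℝ := ((j : ℝ) + 1) * t with hs
  have hs0 : 0 < s := by positivity
  have hx : Real.exp (-s) < 1 := Real.exp_lt_one_iff.2 (by linarith)
  have hgeo : ∑ k ∈ Finset.range N, Real.exp (-s) ^ (k + 1) ≤ 1 / s := by
    have hsum := (hasSum_geometric_of_lt_one (Real.exp_pos (-s)).le hx).mul_left (Real.exp (-s))
    have hle := sum_le_hasSum (Finset.range N) (fun k _ => by positivity) hsum
    simp only [← pow_succ'] at hle
    refine hle.trans ?_
    have hp := one_sub_exp_neg_pos hs0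
    rw [← div_eq_mul_inv, div_le_div_iff₀ hp hs0]
    have h3 : Real.exp (-s) * Real.exp s = 1 := by rw [← Real.exp_add]; simp
    have h4 := Real.add_one_le_exp s
    nlinarith [Real.exp_pos (-s)]
  have hterm : ∀ k : ℕ, Real.exp (-((j : ℝ) + 1) * (t * ((k : ℝ) + 1))) / ((j : ℝ) + 1) =
      Real.exp (-s) ^ (k + 1) / ((j : ℝ) + 1) := by
    intro k
    rw [← Real.exp_nat_mul]
    push_cast
    rw [hs]
    ring_nf
  simp only [hterm, ← Finset.sum_div]
  refine (div_le_div_of_nonneg_right hgeo (by positivity)).trans (le_of_eq ?_)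
  rw [hs]
  field_simp

theorem tendsto_mul_ell_atTop : Tendsto (fun s => s * ell s) atTop (nhds 0) := by
  have hlim : Tendsto (fun s : ℝ => (1 + s / 2)⁻¹) atTop (nhds 0) :=
    tendsto_inv_atTop_zero.comp
      (tendsto_atTop_add_const_left _ _ (tendsto_id.atTop_div_const (by norm_num)))
  refine squeeze_zero' ?_ ?_ hlim
  · filter_upwards [eventually_gt_atTop 0] with s hs
    exact mul_nonneg hs.le (ell_nonneg hs)
  · filter_upwards [eventually_gt_atTop 0] with s hs
    have h := mul_le_mul_of_nonneg_left (ell_le hs) hs.le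
    refine h.trans ?_
    have h2 := Real.quadratic_le_exp_of_nonneg hs.le
    rw [mul_one_div, inv_eq_one_div, div_le_div_iff₀ (by nlinarith) (by positivity)]
    nlinarith

/-! ### The maximum of the functional -/

/-- Half of the maximum of the functional; the optimal slope at `x` is `tanh (optRate * x)`. -/
noncomputable def optRate : ℝ := Real.pi / (2 * √3)

theorem optRate_pos : 0 < optRate := by
  have := Real.pi_pos
  unfold optRate
  positivity

theorem optRate_sq : optRate ^ 2 = Real.pi ^ 2 / 12 := by
  rw [optRate, div_pow, mul_pow, Real.sq_sqrt (by norm_num)]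
  norm_num

theorem integrableOn_log_one_add_exp_neg_mul :
    IntegrableOn (fun x => Real.log (1 + Real.exp (-2 * (optRate * x)))) (Set.Ioi 0) := by
  have hc := optRate_pos
  have h := (integrableOn_Ioi_comp_mul_left_iff
    (fun y => Real.log (1 + Real.exp (-y))) 0 (by positivity : 0 < 2 * optRate)).2
    (by simpa using integrableOn_log_one_add_exp_neg)
  refine h.congr_fun (fun x _ => ?_) measurableSet_Ioi
  ring_nf

theorem integral_log_one_add_exp_neg_mul :
    ∫ x in Set.Ioi (0 : ℝ), Real.log (1 + Real.exp (-2 * (optRate * x))) = optRate / 2 := by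
  have hc := optRate_pos
  have h := integral_comp_mul_left_Ioi (fun y => Real.log (1 + Real.exp (-y))) 0
    (by positivity : 0 < 2 * optRate)
  rw [mul_zero, integral_log_one_add_exp_neg, smul_eq_mul] at h
  have h2 : ∀ x : ℝ, -2 * (optRate * x) = -(2 * optRate * x) := fun x => by ring
  simp only [h2]
  rw [h]
  have := optRate_sq
  field_simp
  linarith

theorem abs_deriv_le_one {f : ℝ → ℝ} (hf : LipschitzWith 1 f) (x : ℝ) :
    -1 ≤ deriv f x ∧ deriv f x ≤ 1 := by
  have := norm_deriv_le_of_lipschitz (x₀ := x) hf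
  rw [Real.norm_eq_abs] at this
  exact abs_le.1 (by simpa using this)

theorem measurable_phi_deriv {f : ℝ → ℝ} (hf : LipschitzWith 1 f) :
    Measurable fun x => phi (deriv f x) := by
  have : (fun x => phi (deriv f x)) = fun x => Real.binEntropy ((1 + deriv f x) / 2) :=
    funext fun x => phi_eq_binEntropy (abs_deriv_le_one hf x).1 (abs_deriv_le_one hf x).2
  rw [this]
  exact Real.binEntropy_continuous.measurable.comp
    (((measurable_deriv f).const_add 1).div_const 2)

theorem phi_deriv_nonneg {f : ℝ → ℝ} (hf : LipschitzWith 1 f) (x : ℝ) :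
    0 ≤ phi (deriv f x) :=
  phi_nonneg (abs_deriv_le_one hf x).1 (abs_deriv_le_one hf x).2

theorem phi_deriv_le {f : ℝ → ℝ} (hf : LipschitzWith 1 f) (x : ℝ) :
    phi (deriv f x) ≤ Real.log 2 := by
  rw [phi_eq_binEntropy (abs_deriv_le_one hf x).1 (abs_deriv_le_one hf x).2]
  exact Real.binEntropy_le_log_two

/-- Gibbs' inequality at `t = optRate * x`, followed by integration by parts of `x * (f' - 1)`. The
boundary term at `R` has a favourable sign because `f R ≥ R`. A bound uniform in `R` yields
integrability as well as the estimate on the half-line. -/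
theorem intervalIntegral_phi_deriv_le {f : ℝ → ℝ} (hf : LipschitzWith 1 f)
    (hge : ∀ x, |x| ≤ f x) (hint : IntegrableOn (fun x => f x - |x|) (Set.Ioi 0))
    {R : ℝ} (hR : 0 ≤ R) :
    ∫ x in (0 : ℝ)..R, phi (deriv f x) ≤
      optRate * (∫ x in Set.Ioi (0 : ℝ), (f x - |x|)) + optRate / 2 := by
  have hc := optRate_pos
  set g : ℝ → ℝ := fun x => f x - x with hg
  have hgL : LipschitzWith (1 + 1) g := hf.sub LipschitzWith.id
  have hgac : AbsolutelyContinuousOnInterval g 0 R :=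
    (hgL.lipschitzOnWith (s := Set.uIcc 0 R)).absolutelyContinuousOnInterval
  have hidac : AbsolutelyContinuousOnInterval (fun x : ℝ => x) 0 R :=
    (LipschitzWith.id.lipschitzOnWith (s := Set.uIcc 0 R)).absolutelyContinuousOnInterval
  have hparts := hidac.integral_mul_deriv_eq_deriv_mul hgac
  simp only [deriv_id'', one_mul, zero_mul, sub_zero] at hparts
  have hgi : IntervalIntegrable (fun x => x * deriv g x) volume 0 R :=
    hgac.intervalIntegrable_deriv.continuousOn_mul hidac.continuousOn
  have hexpc : Continuous fun x => Real.log (1 + Real.exp (-2 * (optRate * x))) := by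
    refine Continuous.log (by fun_prop) fun x => ?_
    positivity
  have hb : ∀ x, ‖phi (deriv f x)‖ ≤ Real.log 2 := fun x => by
    rw [Real.norm_of_nonneg (phi_deriv_nonneg hf x)]; exact phi_deriv_le hf x
  have hphi : IntervalIntegrable (fun x => phi (deriv f x)) volume 0 R := by
    rw [intervalIntegrable_iff]
    exact Measure.integrableOn_of_bounded (M := Real.log 2) (by simp)
      (measurable_phi_deriv hf).aestronglyMeasurable (Eventually.of_forall hb)
  have h1 : ∫ x in (0 : ℝ)..R, phi (deriv f x) ≤
      ∫ x in (0 : ℝ)..R, (-optRate * (x * deriv g x) +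
        Real.log (1 + Real.exp (-2 * (optRate * x)))) := by
    refine intervalIntegral.integral_mono_ae hR hphi
      ((hgi.const_mul _).add (hexpc.intervalIntegrable _ _)) ?_
    filter_upwards [hf.ae_differentiableAt_real] with x hx
    have hd : deriv g x = deriv f x - 1 := by
      rw [hg, deriv_fun_sub hx differentiableAt_fun_id, deriv_id'']
    have := phi_le_tilt (abs_deriv_le_one hf x).1 (abs_deriv_le_one hf x).2 (optRate * x)
    rw [hd]
    linarith
  rw [intervalIntegral.integral_add (hgi.const_mul _) (hexpc.intervalIntegrable _ _),
    intervalIntegral.integral_const_mul, hparts] at h1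
  have h2 : ∫ x in (0 : ℝ)..R, Real.log (1 + Real.exp (-2 * (optRate * x))) ≤ optRate / 2 := by
    rw [intervalIntegral.integral_of_le hR, ← integral_log_one_add_exp_neg_mul]
    refine setIntegral_mono_set integrableOn_log_one_add_exp_neg_mul ?_
      (Set.Ioc_subset_Ioi_self.eventuallyLE)
    refine Eventually.of_forall fun x => Real.log_nonneg ?_
    linarith [Real.exp_pos (-2 * (optRate * x))]
  have h3 : ∫ x in (0 : ℝ)..R, g x ≤ ∫ x in Set.Ioi (0 : ℝ), (f x - |x|) := by
    have : ∫ x in (0 : ℝ)..R, g x = ∫ x in Set.Ioc 0 R, (f x - |x|) := by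
      rw [intervalIntegral.integral_of_le hR]
      refine setIntegral_congr_fun measurableSet_Ioc fun x hx => ?_
      simp only [hg, abs_of_pos hx.1]
    rw [this]
    exact setIntegral_mono_set hint (Eventually.of_forall fun x => sub_nonneg.2 (hge x))
      (Set.Ioc_subset_Ioi_self.eventuallyLE)
  have h4 : 0 ≤ R * g R := mul_nonneg hR (by
    have := hge R
    rw [abs_of_nonneg hR] at this
    simp only [hg]; linarith)
  nlinarith

theorem integrableOn_phi_deriv_Ioi {f : ℝ → ℝ} (hf : LipschitzWith 1 f)
    (hge : ∀ x, |x| ≤ f x) (hint : IntegrableOn (fun x => f x - |x|) (Set.Ioi 0)) :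
    IntegrableOn (fun x => phi (deriv f x)) (Set.Ioi 0) := by
  refine integrableOn_Ioi_of_intervalIntegral_norm_bounded (l := atTop) (b := fun R : ℝ => R)
    (optRate * (∫ x in Set.Ioi (0 : ℝ), (f x - |x|)) + optRate / 2) 0 (fun R => ?_)
    tendsto_id ?_
  · refine Measure.integrableOn_of_bounded (M := Real.log 2) (by simp)
      (measurable_phi_deriv hf).aestronglyMeasurable (Eventually.of_forall fun x => ?_)
    rw [Real.norm_of_nonneg (phi_deriv_nonneg hf x)]
    exact phi_deriv_le hf x
  · filter_upwards [eventually_ge_atTop 0] with R hR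
    simp only [Real.norm_of_nonneg (phi_deriv_nonneg hf _)]
    exact intervalIntegral_phi_deriv_le hf hge hint hR

theorem integral_phi_deriv_Ioi_le {f : ℝ → ℝ} (hf : LipschitzWith 1 f)
    (hge : ∀ x, |x| ≤ f x) (hint : IntegrableOn (fun x => f x - |x|) (Set.Ioi 0)) :
    ∫ x in Set.Ioi (0 : ℝ), phi (deriv f x) ≤
      optRate * (∫ x in Set.Ioi (0 : ℝ), (f x - |x|)) + optRate / 2 := by
  refine le_of_tendsto (intervalIntegral_tendsto_integral_Ioi 0
    (integrableOn_phi_deriv_Ioi hf hge hint) tendsto_id) ?_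
  filter_upwards [eventually_ge_atTop 0] with R hR
  exact intervalIntegral_phi_deriv_le hf hge hint hR

theorem integrableOn_comp_neg_Ioi {g : ℝ → ℝ} :
    IntegrableOn (fun x => g (-x)) (Set.Ioi 0) ↔ IntegrableOn g (Set.Iic 0) := by
  rw [integrableOn_Iic_iff_integrableOn_Iio,
    ← (Measure.measurePreserving_neg (volume : Measure ℝ)).integrableOn_comp_preimage
      (Homeomorph.neg ℝ).measurableEmbedding]
  simp [Function.comp_def]

theorem phi_deriv_comp_neg {f : ℝ → ℝ} (hf : LipschitzWith 1 f) (x : ℝ) :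
    phi (deriv (fun y => f (-y)) x) = phi (deriv f (-x)) := by
  rw [deriv_comp_neg, phi_neg _ (abs_deriv_le_one hf _).1 (abs_deriv_le_one hf _).2]

/-- The negative half-line reduces to the positive one by reflection, since φ is even. The area
constraint enters once the two halves are added: `c * 1 + 2 * (c / 2) = 2c`. -/
theorem integrable_phi_deriv_and_le {f : ℝ → ℝ} (h : f ∈ spaceX) :
    Integrable (fun x => phi (deriv f x)) ∧ functionalF f ≤ 2 * optRate := by
  obtain ⟨hf, hge, hint, hle⟩ := h
  have hfn : LipschitzWith 1 fun x => f (-x) := by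
    have := hf.comp (LipschitzWith.id (α := ℝ)).neg
    rw [mul_one] at this
    exact this
  have hgen : ∀ x, |x| ≤ f (-x) := fun x => by simpa using hge (-x)
  have hwn : (fun x => f (-x) - |x|) = fun x => (fun y => f y - |y|) (-x) := by simp
  have hintn : IntegrableOn (fun x => f (-x) - |x|) (Set.Ioi 0) := by
    rw [hwn, integrableOn_comp_neg_Ioi (g := fun y => f y - |y|)]
    exact hint.integrableOn
  have hI1 := integrableOn_phi_deriv_Ioi hf hge hint.integrableOn
  have hI2 := integrableOn_phi_deriv_Ioi hfn hgen hintn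
  have hL1 := integral_phi_deriv_Ioi_le hf hge hint.integrableOn
  have hL2 := integral_phi_deriv_Ioi_le hfn hgen hintn
  simp only [phi_deriv_comp_neg hf] at hI2 hL2
  rw [integrableOn_comp_neg_Ioi (g := fun x => phi (deriv f x))] at hI2
  rw [hwn, integral_comp_neg_Ioi 0 (fun y => f y - |y|),
    integral_comp_neg_Ioi 0 (fun x => phi (deriv f x)), neg_zero] at hL2
  have hI : Integrable (fun x => phi (deriv f x)) := by
    rw [← integrableOn_univ, ← Set.Iic_union_Ioi (a := (0 : ℝ))]
    exact hI2.union hI1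
  refine ⟨hI, ?_⟩
  rw [functionalF, ← intervalIntegral.integral_Iic_add_Ioi hI2 hI1]
  rw [← intervalIntegral.integral_Iic_add_Ioi (b := 0) hint.integrableOn hint.integrableOn] at hle
  have := mul_le_mul_of_nonneg_left hle optRate_pos.le
  linarith

/-- The maximiser of the functional. -/
noncomputable def optShape (x : ℝ) : ℝ :=
  Real.log (Real.exp (optRate * x) + Real.exp (-(optRate * x))) / optRate

theorem hasDerivAt_optShape (x : ℝ) : HasDerivAt optShape (Real.tanh (optRate * x)) x := by
  have hc := optRate_pos
  have h1 : HasDerivAt (fun x => optRate * x) optRate x := by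
    simpa using (hasDerivAt_id x).const_mul optRate
  have h := (((h1.exp).fun_add (h1.fun_neg.exp)).log (by positivity)).div_const optRate
  refine h.congr_deriv ?_
  rw [Real.tanh_eq]
  field_simp
  ring

theorem optShape_neg (x : ℝ) : optShape (-x) = optShape x := by
  simp only [optShape, mul_neg, neg_neg, add_comm]

theorem optShape_sub_abs (x : ℝ) :
    optShape x - |x| = Real.log (1 + Real.exp (-2 * (optRate * |x|))) / optRate := by
  have hc := optRate_pos
  have h : optShape x = optShape |x| := by
    rcases abs_choice x with h | h <;> rw [h]
    rw [optShape_neg]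
  rw [h, optShape, show Real.exp (optRate * |x|) + Real.exp (-(optRate * |x|)) =
    Real.exp (optRate * |x|) * (1 + Real.exp (-2 * (optRate * |x|))) by
      rw [mul_add, ← Real.exp_add]; ring_nf,
    Real.log_mul (by positivity) (by positivity), Real.log_exp]
  field_simp
  ring

theorem lipschitzWith_optShape : LipschitzWith 1 optShape := by
  refine lipschitzWith_of_nnnorm_deriv_le (fun x => (hasDerivAt_optShape x).differentiableAt)
    fun x => ?_
  rw [(hasDerivAt_optShape x).deriv, ← NNReal.coe_le_coe, coe_nnnorm, Real.norm_eq_abs]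
  exact abs_le.2 (abs_tanh_le_one _)

theorem abs_le_optShape (x : ℝ) : |x| ≤ optShape x := by
  rw [← sub_nonneg, optShape_sub_abs]
  refine div_nonneg (Real.log_nonneg ?_) optRate_pos.le
  linarith [Real.exp_pos (-2 * (optRate * |x|))]

theorem integral_optShape : ∫ x, (optShape x - |x|) = 1 := by
  have hc := optRate_pos
  simp only [optShape_sub_abs]
  rw [integral_comp_abs (f := fun y => Real.log (1 + Real.exp (-2 * (optRate * y))) / optRate),
    integral_div, integral_log_one_add_exp_neg_mul]
  field_simp

theorem optShape_mem : optShape ∈ spaceX := by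
  refine ⟨lipschitzWith_optShape, abs_le_optShape, ?_, integral_optShape.le⟩
  by_contra h
  have := integral_optShape
  rw [integral_undef h] at this
  norm_num at this

theorem functionalF_optShape : functionalF optShape = 2 * optRate := by
  have hc := optRate_pos
  set G : ℝ → ℝ := fun y => phi (Real.tanh (optRate * y)) with hG
  set H : ℝ → ℝ := fun y => Real.log (1 + Real.exp (-2 * (optRate * y))) with hH
  have hphi : ∀ x, phi (deriv optShape x) = G |x| := by
    intro x
    rw [(hasDerivAt_optShape x).deriv, hG]
    rcases abs_choice x with h | h <;> rw [h]
    beta_reduce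
    rw [mul_neg, Real.tanh_neg, phi_neg _ (abs_tanh_le_one _).1 (abs_tanh_le_one _).2]
  have hGint : IntegrableOn G (Set.Ioi 0) := by
    refine ((integrable_phi_deriv_and_le optShape_mem).1.integrableOn
      (s := Set.Ioi 0)).congr_fun (fun x hx => ?_) measurableSet_Ioi
    beta_reduce
    rw [hphi, abs_of_pos hx]
  -- Equality in Gibbs' inequality reads `G y = c y (1 - tanh (c y)) + H y`, and `H' y = -c (1 -
  -- tanh (c y))`. Thus `2H - G` is the derivative of `y H y`, which vanishes at both ends, and `∫ G
  -- = 2 ∫ H`.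
  have hHder : ∀ y, HasDerivAt (fun y => y * H y) (2 * H y - G y) y := by
    intro y
    have h1 : HasDerivAt (fun x => -2 * (optRate * x)) (-2 * optRate) y := by
      simpa using ((hasDerivAt_id y).const_mul optRate).const_mul (-2)
    have h2 := (h1.exp.const_add 1).log (by positivity)
    refine ((hasDerivAt_id' y).fun_mul h2).congr_deriv ?_
    simp only [hG, hH, phi_tanh]
    have he : Real.exp (-2 * (optRate * y)) =
        Real.exp (-(optRate * y)) / Real.exp (optRate * y) := by
      rw [← Real.exp_sub]; ring_nf
    rw [Real.tanh_eq, he]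
    field_simp
    ring
  have hlim : Tendsto (fun y => y * H y) atTop (nhds 0) := by
    have h0 : Tendsto (fun y : ℝ => (2 * optRate)⁻¹ *
        ((2 * optRate * y) ^ 1 * Real.exp (-(2 * optRate * y)))) atTop
        (nhds ((2 * optRate)⁻¹ * 0)) :=
      ((Real.tendsto_pow_mul_exp_neg_atTop_nhds_zero 1).comp
        (tendsto_id.const_mul_atTop (by positivity : 0 < 2 * optRate))).const_mul _
    rw [mul_zero] at h0
    refine squeeze_zero' ?_ ?_ h0
    · filter_upwards [eventually_ge_atTop 0] with y hy
      refine mul_nonneg hy (Real.log_nonneg ?_)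
      linarith [Real.exp_pos (-2 * (optRate * y))]
    · filter_upwards [eventually_ge_atTop 0] with y hy
      have h1 : H y ≤ Real.exp (-2 * (optRate * y)) := by
        have := Real.log_le_sub_one_of_pos
          (by positivity : 0 < 1 + Real.exp (-2 * (optRate * y)))
        simp only [hH]; linarith
      refine (mul_le_mul_of_nonneg_left h1 hy).trans (le_of_eq ?_)
      rw [show -2 * (optRate * y) = -(2 * optRate * y) by ring]
      field_simp
  have hHint := integrableOn_log_one_add_exp_neg_mul
  have hFTC := integral_Ioi_of_hasDerivAt_of_tendsto' (a := 0) (fun y _ => hHder y)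
    ((hHint.const_mul 2).sub hGint) hlim
  rw [integral_sub (hHint.const_mul 2) hGint, integral_const_mul,
    integral_log_one_add_exp_neg_mul] at hFTC
  rw [functionalF]
  simp only [hphi]
  rw [integral_comp_abs (f := G)]
  linarith

theorem isGreatest_functionalF : IsGreatest (functionalF '' spaceX) (2 * optRate) :=
  ⟨⟨optShape, optShape_mem, functionalF_optShape⟩, by
    rintro _ ⟨f, hf, rfl⟩
    exact (integrable_phi_deriv_and_le hf).2⟩

/-! ### Rows of a partition -/

theorem _root_.List.sum_range_getD (l : List ℕ) {N : ℕ} (hN : l.length ≤ N) :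
    ∑ i ∈ Finset.range N, l.getD i 0 = l.sum := by
  induction l generalizing N with
  | nil => simp
  | cons a l ih =>
    obtain ⟨N, rfl⟩ : ∃ k, N = k + 1 := ⟨N - 1, by simp at hN; omega⟩
    rw [Finset.sum_range_succ', List.sum_cons]
    simp only [List.getD_cons_succ, List.getD_cons_zero]
    rw [ih (by simpa using hN), add_comm]

variable {m n : ℕ}

theorem row_eq_zero {lam : n.Partition} {i : ℕ} (hi : Multiset.card lam.parts ≤ i) :
    row lam i = 0 :=
  List.getD_eq_default _ _ (by rwa [Multiset.length_sort])

theorem row_mem {lam : n.Partition} {i : ℕ} (hi : i < Multiset.card lam.parts) :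
    row lam i ∈ lam.parts := by
  have hi' : i < (lam.parts.sort (fun a b => b ≤ a)).length := by rwa [Multiset.length_sort]
  rw [row, List.getD_eq_getElem _ _ hi', ← Multiset.mem_sort (r := fun a b => b ≤ a)]
  exact List.getElem_mem hi'

theorem row_pos {lam : n.Partition} {i : ℕ} (hi : i < Multiset.card lam.parts) :
    0 < row lam i := lam.parts_pos (row_mem hi)

theorem row_le (lam : n.Partition) (i : ℕ) : row lam i ≤ n := by
  rcases lt_or_ge i (Multiset.card lam.parts) with hi | hi
  · exact lam.le_of_mem_parts (row_mem hi)
  · rw [row_eq_zero hi]; exact Nat.zero_le _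

theorem row_antitone (lam : n.Partition) : Antitone (row lam) := by
  intro i j hij
  rcases lt_or_ge j (Multiset.card lam.parts) with hj | hj
  · have hj' : j < (lam.parts.sort (fun a b => b ≤ a)).length := by rwa [Multiset.length_sort]
    have hi' := hij.trans_lt hj'
    rw [row, row, List.getD_eq_getElem _ _ hj', List.getD_eq_getElem _ _ hi']
    rcases hij.eq_or_lt with rfl | hij
    · exact le_rfl
    · exact List.pairwise_iff_getElem.1 (Multiset.pairwise_sort lam.parts _) i j hi' hj' hij
  · rw [row_eq_zero hj]; exact Nat.zero_le _

theorem sum_row (lam : n.Partition) {N : ℕ} (hN : Multiset.card lam.parts ≤ N) :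
    ∑ i ∈ Finset.range N, row lam i = n := by
  have h := List.sum_range_getD (lam.parts.sort (fun a b => b ≤ a)) (N := N)
    (by rwa [Multiset.length_sort])
  rw [← Multiset.sum_coe, Multiset.sort_eq, lam.parts_sum] at h
  exact h

theorem card_parts_le (lam : n.Partition) : Multiset.card lam.parts ≤ n := by
  conv_rhs => rw [← sum_row lam le_rfl]
  calc Multiset.card lam.parts = ∑ i ∈ Finset.range (Multiset.card lam.parts), 1 := by simp
    _ ≤ _ := Finset.sum_le_sum fun i hi => row_pos (Finset.mem_range.1 hi)

theorem exists_partition_row_eq {r : ℕ → ℕ} (hr : Antitone r) {N : ℕ}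
    (hN : ∀ i, N ≤ i → r i = 0) (hsum : ∑ i ∈ Finset.range N, r i = n) :
    ∃ lam : n.Partition, row lam = r := by
  have hex : ∃ k, r k = 0 := ⟨N, hN N le_rfl⟩
  -- Parts must be positive, so the list is cut at the first zero of `r`.
  set k := Nat.find hex with hk
  have hzero : ∀ i, k ≤ i → r i = 0 := fun i hi =>
    Nat.le_zero.1 ((hr hi).trans_eq (Nat.find_spec hex))
  have hpos : ∀ i, i < k → 0 < r i := fun i hi => Nat.pos_of_ne_zero (Nat.find_min hex hi)
  have hkN : k ≤ N := Nat.find_min' hex (hN N le_rfl)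
  have hget : ∀ i, ((List.range k).map r).getD i 0 = r i := by
    intro i
    rcases lt_or_ge i k with hi | hi
    · rw [List.getD_eq_getElem _ _ (by simpa using hi)]; simp
    · rw [List.getD_eq_default _ _ (by simpa using hi), hzero i hi]
  refine ⟨⟨((List.range k).map r : List ℕ), ?_, ?_⟩, funext fun i => ?_⟩
  · intro i hi
    simp only [Multiset.mem_coe, List.mem_map, List.mem_range] at hi
    obtain ⟨j, hj, rfl⟩ := hi
    exact hpos j hj
  · rw [Multiset.sum_coe, ← List.sum_range_getD _ (N := N) (by simpa using hkN), ← hsum]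
    exact Finset.sum_congr rfl fun i _ => hget i
  · rw [row, ← hget i]
    congr 1
    refine List.Perm.eq_of_pairwise' (Multiset.pairwise_sort _ _) ?_ ?_
    · rw [List.pairwise_map]
      exact List.pairwise_lt_range.imp fun h => hr h.le
    · rw [← Multiset.coe_eq_coe, Multiset.sort_eq]

/-! ### Counting subpartitions from above -/

theorem size_le_of_isSubpartition {nu : m.Partition} {lam : n.Partition}
    (h : IsSubpartition nu lam) : m ≤ n := by
  rw [← sum_row nu le_rfl, ← sum_row lam le_rfl]
  refine (Finset.sum_le_sum fun i hi => h.2 i (Finset.mem_range.1 hi)).trans ?_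
  exact Finset.sum_le_sum_of_subset (Finset.range_subset_range.2 h.1)

theorem subpartitions_subset (lam : n.Partition) :
    {nu : (m : ℕ) × m.Partition | IsSubpartition nu.2 lam} ⊆
      ((Finset.range (n + 1)).sigma fun m => (Finset.univ : Finset m.Partition) :
        Finset ((m : ℕ) × m.Partition)) := by
  rintro ⟨m, nu⟩ h
  have := size_le_of_isSubpartition h
  simpa using Nat.lt_succ_of_le this

/-- `Set.ncard` is zero on infinite sets, so lower bounds for the count depend on this finiteness.
-/
theorem finite_subpartitions (lam : n.Partition) :
    {nu : (m : ℕ) × m.Partition | IsSubpartition nu.2 lam}.Finite :=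
  (Finset.finite_toSet _).subset (subpartitions_subset lam)

theorem sum_mul_count (nu : m.Partition) (hmn : m ≤ n) :
    ∑ k : Fin n, (k.1 + 1) * nu.parts.count (k.1 + 1) = m := by
  have h := Finset.sum_multiset_count_of_subset nu.parts (Finset.range (n + 1)) (by
    intro i hi
    have := nu.le_of_mem_parts (Multiset.mem_toFinset.1 hi)
    exact Finset.mem_range.2 (by omega))
  rw [nu.parts_sum, Finset.sum_range_succ'] at h
  rw [Fin.sum_univ_eq_sum_range (fun k => (k + 1) * nu.parts.count (k + 1)) n]
  conv_rhs => rw [h]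
  simp [mul_comm]

/-- Give a partition of `m` the weight `exp (-t m)`. Partitions of size at most `n` are determined
by the multiplicities of the parts `1, …, n`, so their total weight is at most a product of
geometric series, `exp (∑ ell (t k))`. Each weight is at least `exp (-t n)`. -/
theorem numSubpartitions_le_exp (lam : n.Partition) {t : ℝ} (ht : 0 < t) :
    (numSubpartitions lam : ℝ) ≤ Real.exp (t * n + Real.pi ^ 2 / (6 * t)) := by
  classical
  set T : Finset ((m : ℕ) × m.Partition) :=
    (Finset.range (n + 1)).sigma fun m => (Finset.univ : Finset m.Partition) with hT
  have hTle : ∀ p ∈ T, p.1 ≤ n := fun p hp => by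
    simp only [hT, Finset.mem_sigma, Finset.mem_range] at hp
    omega
  have hcard : numSubpartitions lam ≤ T.card := by
    rw [numSubpartitions, ← Set.ncard_coe_finset T]
    exact Set.ncard_le_ncard (subpartitions_subset lam) (Finset.finite_toSet _)
  set w : Fin n → ℕ → ℝ := fun k c => Real.exp (-(t * ((k.1 : ℝ) + 1))) ^ c with hw
  set cnt : ((m : ℕ) × m.Partition) → Fin n → ℕ := fun p k => p.2.parts.count (k.1 + 1)
  have hinj : Set.InjOn cnt T := by
    rintro ⟨m, nu⟩ hm ⟨m', nu'⟩ hm' h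
    have h1 := hTle _ hm
    have h2 := hTle _ hm'
    have hparts : nu.parts = nu'.parts := by
      ext i
      rcases Nat.eq_zero_or_pos i with rfl | hi
      · rw [Multiset.count_eq_zero_of_notMem fun h => (nu.parts_pos h).ne' rfl,
          Multiset.count_eq_zero_of_notMem fun h => (nu'.parts_pos h).ne' rfl]
      rcases le_or_gt i n with hin | hin
      · have := congrFun h ⟨i - 1, by omega⟩
        simpa [cnt, Nat.sub_add_cancel hi] using this
      · rw [Multiset.count_eq_zero_of_notMem fun h => by
            have := nu.le_of_mem_parts h; simp only at h1; omega,
          Multiset.count_eq_zero_of_notMem fun h => by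
            have := nu'.le_of_mem_parts h; simp only at h2; omega]
    have hmm : m = m' := by rw [← nu.parts_sum, ← nu'.parts_sum, hparts]
    subst hmm
    exact congrArg _ (Nat.Partition.ext hparts)
  have hweight : ∀ p ∈ T, ∏ k, w k (cnt p k) = Real.exp (-(t * p.1)) := by
    intro p hp
    have h := sum_mul_count p.2 (hTle p hp)
    have h' : (p.1 : ℝ) = ∑ k : Fin n, ((k.1 : ℝ) + 1) * (cnt p k : ℝ) := by
      conv_lhs => rw [← h]
      push_cast
      rfl
    simp only [hw, ← Real.exp_nat_mul]
    rw [← Real.exp_sum, h', Finset.mul_sum, ← Finset.sum_neg_distrib]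
    congr 1
    exact Finset.sum_congr rfl fun k _ => by ring
  have hmem : ∀ p ∈ T, cnt p ∈ Fintype.piFinset fun _ : Fin n => Finset.range (n + 1) := by
    intro p hp
    rw [Fintype.mem_piFinset]
    intro k
    rw [Finset.mem_range, Nat.lt_succ_iff]
    refine (Multiset.count_le_card _ _).trans ((card_parts_le p.2).trans (hTle p hp))
  have h1 : ∑ p ∈ T, Real.exp (-(t * p.1)) ≤
      ∏ k : Fin n, ∑ c ∈ Finset.range (n + 1), w k c := by
    rw [Finset.prod_univ_sum, ← Finset.sum_congr rfl hweight,
      ← Finset.sum_image (f := fun g : Fin n → ℕ => ∏ k, w k (g k)) hinj]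
    refine Finset.sum_le_sum_of_subset_of_nonneg ?_ fun g _ _ =>
      Finset.prod_nonneg fun k _ => by positivity
    intro g hg
    obtain ⟨p, hp, rfl⟩ := Finset.mem_image.1 hg
    exact hmem p hp
  have h2 : ∏ k : Fin n, ∑ c ∈ Finset.range (n + 1), w k c ≤
      ∏ k : Fin n, Real.exp (ell (t * ((k.1 : ℝ) + 1))) := by
    refine Finset.prod_le_prod (fun k _ => Finset.sum_nonneg fun c _ => by positivity)
      fun k _ => ?_
    have hs : 0 < t * ((k.1 : ℝ) + 1) := by positivity
    have hx := one_sub_exp_neg_pos hs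
    have := sum_le_hasSum (Finset.range (n + 1)) (fun c _ => by positivity)
      (hasSum_geometric_of_lt_one (Real.exp_pos (-(t * ((k.1 : ℝ) + 1)))).le (by linarith))
    rwa [ell, Real.exp_neg, Real.exp_log hx]
  rw [← Real.exp_sum, Fin.sum_univ_eq_sum_range (fun k => ell (t * ((k : ℝ) + 1))) n] at h2
  have h3 : (T.card : ℝ) * Real.exp (-(t * n)) ≤ ∑ p ∈ T, Real.exp (-(t * p.1)) := by
    rw [← nsmul_eq_mul]
    refine Finset.card_nsmul_le_sum _ _ _ fun p hp => Real.exp_le_exp.2 ?_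
    have : (p.1 : ℝ) ≤ n := by exact_mod_cast hTle p hp
    nlinarith
  have h4 := h3.trans (h1.trans (h2.trans (Real.exp_le_exp.2 (sum_ell_le ht n))))
  have h5 : (numSubpartitions lam : ℝ) ≤ T.card := by exact_mod_cast hcard
  rw [Real.exp_neg, ← div_eq_mul_inv, div_le_iff₀ (Real.exp_pos _)] at h4
  rw [Real.exp_add, mul_comm]
  exact h5.trans h4

/-! ### Counting subpartitions from below -/

theorem exists_subpartition_row_eq (lam : n.Partition) {f : ℕ → ℕ} (hf : Antitone f)
    (hle : ∀ i, f i ≤ row lam i) :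
    ∃ nu : (m : ℕ) × m.Partition, IsSubpartition nu.2 lam ∧ row nu.2 = f := by
  obtain ⟨nu, hnu⟩ := exists_partition_row_eq (n := ∑ i ∈ Finset.range n, f i) hf (N := n)
    (fun i hi => Nat.le_zero.1 ((hle i).trans_eq (row_eq_zero ((card_parts_le lam).trans hi))))
    rfl
  refine ⟨⟨_, nu⟩, ⟨?_, fun i _ => ?_⟩, hnu⟩
  · by_contra! hlt
    have h1 := row_pos hlt
    rw [hnu] at h1
    have h2 := hle (Multiset.card lam.parts)
    rw [row_eq_zero le_rfl] at h2
    omega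
  · simp only [hnu]; exact hle i

theorem card_le_numSubpartitions (lam : n.Partition) {ι : Type*} [Fintype ι]
    (f : ι → ℕ → ℕ) (hf : ∀ a, Antitone (f a)) (hle : ∀ a i, f a i ≤ row lam i)
    (hinj : Function.Injective f) : Fintype.card ι ≤ numSubpartitions lam := by
  choose g hg1 hg2 using fun a => exists_subpartition_row_eq lam (hf a) (hle a)
  have hginj : Function.Injective g := by
    intro a b hab
    refine hinj ?_
    rw [← hg2 a, ← hg2 b, hab]
  rw [numSubpartitions, ← Nat.card_eq_fintype_card, ← Set.ncard_univ]
  exact Set.ncard_le_ncard_of_injOn g (fun a _ => hg1 a) hginj.injOn (finite_subpartitions lam)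

/-- The `p`-th largest value of a multiset of `L` elements of `Fin (D + 1)`. -/
def symRow {L D : ℕ} (s : Sym (Fin (D + 1)) L) (p : ℕ) : ℕ :=
  ((s : Multiset (Fin (D + 1))).sort (fun a b => b ≤ a)).getD p 0

theorem symRow_le {L D : ℕ} (s : Sym (Fin (D + 1)) L) (p : ℕ) : symRow s p ≤ D :=
  Nat.lt_succ_iff.1 (Fin.is_lt _)

theorem symRow_anti {L D : ℕ} (s : Sym (Fin (D + 1)) L) (p : ℕ) (hp : p + 1 < L) :
    symRow s (p + 1) ≤ symRow s p := by
  have hl : ((s : Multiset (Fin (D + 1))).sort (fun a b => b ≤ a)).length = L := by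
    rw [Multiset.length_sort]; exact s.2
  rw [symRow, symRow, List.getD_eq_getElem _ _ (by omega), List.getD_eq_getElem _ _ (by omega)]
  exact List.pairwise_iff_getElem.1
    (Multiset.pairwise_sort (s : Multiset (Fin (D + 1))) (fun a b => b ≤ a)) p (p + 1) (by omega)
    (by omega) (by omega)

theorem symRow_injective {L D : ℕ} {s s' : Sym (Fin (D + 1)) L}
    (h : ∀ p < L, symRow s p = symRow s' p) : s = s' := by
  have hl : ∀ s : Sym (Fin (D + 1)) L,
      ((s : Multiset (Fin (D + 1))).sort (fun a b => b ≤ a)).length = L := fun s => by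
    rw [Multiset.length_sort]; exact s.2
  refine Sym.coe_injective ?_
  rw [← Multiset.sort_eq (s : Multiset (Fin (D + 1))) (fun a b => b ≤ a),
    ← Multiset.sort_eq (s' : Multiset (Fin (D + 1))) (fun a b => b ≤ a)]
  congr 1
  refine List.ext_getElem (by rw [hl, hl]) fun p h1 h2 => ?_
  have := h p (by rwa [hl] at h1)
  rw [symRow, symRow, List.getD_eq_getElem _ _ h1, List.getD_eq_getElem _ _ h2] at this
  exact Fin.ext this

/-- Rows in block `i` lie above row `L (i + 1)` of `lam`, so they may form any weakly decreasing
sequence between `r (L (i + 2))` and `r (L (i + 1))`, that is, a multiset of `L` values. The ranges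
of consecutive blocks only touch, so the choices are independent. Row `0` of `lam` does not occur in
the bound. -/
theorem prod_choose_le_numSubpartitions (lam : n.Partition) {L : ℕ} (hL : 0 < L) (B : ℕ) :
    ∏ i ∈ Finset.range B,
      (L + (row lam (L * (i + 1)) - row lam (L * (i + 2)))).choose L ≤ numSubpartitions lam := by
  set r := row lam with hr
  have hanti : Antitone r := row_antitone lam
  set D : ℕ → ℕ := fun i => r (L * (i + 1)) - r (L * (i + 2)) with hD
  have hstep : ∀ i, r (L * (i + 2)) ≤ r (L * (i + 1)) := fun i =>
    hanti (Nat.mul_le_mul_left _ (by omega))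
  let g : ((i : Fin B) → Sym (Fin (D i + 1)) L) → ℕ → ℕ → ℕ := fun s i p =>
    if h : i < B then symRow (s ⟨i, h⟩) p else 0
  have hg_le : ∀ s i p, g s i p ≤ D i := by
    intro s i p
    simp only [g]
    split_ifs with h
    · exact symRow_le (s ⟨i, h⟩) p
    · exact Nat.zero_le _
  have hg_anti : ∀ s i p, p + 1 < L → g s i (p + 1) ≤ g s i p := by
    intro s i p hp
    simp only [g]
    split_ifs with h
    · exact symRow_anti (s ⟨i, h⟩) p hp
    · exact le_rfl
  let f : ((i : Fin B) → Sym (Fin (D i + 1)) L) → ℕ → ℕ := fun s j =>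
    if j / L < B then r (L * (j / L + 2)) + g s (j / L) (j % L) else 0
  have hf_le : ∀ s j, f s j ≤ r (L * (j / L + 1)) := by
    intro s j
    simp only [f]
    split_ifs with h
    · have h1 := hg_le s (j / L) (j % L)
      have h2 := hstep (j / L)
      simp only [hD] at h1
      omega
    · exact Nat.zero_le _
  have hcard : Fintype.card ((i : Fin B) → Sym (Fin (D i + 1)) L) =
      ∏ i ∈ Finset.range B, (L + D i).choose L := by
    rw [Fintype.card_pi, ← Fin.prod_univ_eq_prod_range (fun i => (L + D i).choose L) B]
    refine Finset.prod_congr rfl fun i _ => ?_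
    rw [Sym.card_sym_fin_eq_multichoose, Nat.multichoose_eq]
    congr 1
    omega
  rw [← hcard]
  refine card_le_numSubpartitions lam f (fun s => antitone_nat_of_succ_le fun j => ?_)
    (fun s j => (hf_le s j).trans (hanti ?_)) ?_
  -- Inside a block the order comes from the sorted multiset. Across blocks, the ceiling of the next
  -- block is at most the floor of the current one.
  · by_cases hj : (j + 1) / L = j / L
    · have hm : (j + 1) % L = j % L + 1 := by
        have h1 := Nat.div_add_mod (j + 1) L
        have h2 := Nat.div_add_mod j L
        rw [hj] at h1
        omega
      simp only [f, hj, hm]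
      split_ifs with h
      · have := hg_anti s (j / L) (j % L) (by rw [← hm]; exact Nat.mod_lt _ hL)
        omega
      · exact le_rfl
    · have hj' : j / L + 1 ≤ (j + 1) / L := by
        have : j / L ≤ (j + 1) / L := Nat.div_le_div_right (Nat.le_succ j)
        omega
      by_cases h : (j + 1) / L < B
      · refine (hf_le s (j + 1)).trans ((hanti (Nat.mul_le_mul_left L
          (by omega : j / L + 2 ≤ (j + 1) / L + 1))).trans ?_)
        have h' : j / L < B := by omega
        simp only [f, h', if_true]
        omega
      · simp only [f, h, if_false]
        exact Nat.zero_le _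
  · have h1 := Nat.div_add_mod j L
    have h2 := Nat.mod_lt j hL
    rw [Nat.mul_add, Nat.mul_one]
    omega
  · intro s s' hss
    funext i
    refine symRow_injective fun p hp => ?_
    have hdiv : (L * i.1 + p) / L = i.1 := by
      rw [Nat.mul_add_div hL, Nat.div_eq_of_lt hp, add_zero]
    have hmod : (L * i.1 + p) % L = p := by
      rw [Nat.mul_add_mod, Nat.mod_eq_of_lt hp]
    have := congrFun hss (L * i.1 + p)
    simp only [f, hdiv, hmod, i.2, if_true] at this
    have hgi : ∀ s, g s i.1 p = symRow (s i) p := fun s => by simp [g]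
    rw [← hgi s, ← hgi s']
    exact Nat.add_left_cancel this

/-! ### The lower convex envelope -/

section Envelope

variable {f : ℝ → ℝ}

theorem bddAbove_envelope (f : ℝ → ℝ) (x : ℝ) :
    BddAbove {y : ℝ | ∃ g : ℝ → ℝ, ConvexOn ℝ Set.univ g ∧ (∀ z, g z ≤ f z) ∧ y = g x} :=
  ⟨f x, by rintro _ ⟨g, _, hg, rfl⟩; exact hg x⟩

theorem le_lowerConvexEnvelope {g : ℝ → ℝ} (hg : ConvexOn ℝ Set.univ g) (hle : ∀ z, g z ≤ f z)
    (x : ℝ) : g x ≤ lowerConvexEnvelope f x :=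
  le_csSup (bddAbove_envelope f x) ⟨g, hg, hle, rfl⟩

theorem convexOn_abs : ConvexOn ℝ Set.univ (fun x : ℝ => |x|) :=
  convexOn_univ_norm (E := ℝ)

theorem lowerConvexEnvelope_le_of_forall (hf : ∀ x, |x| ≤ f x) {x C : ℝ}
    (h : ∀ g : ℝ → ℝ, ConvexOn ℝ Set.univ g → (∀ z, g z ≤ f z) → g x ≤ C) :
    lowerConvexEnvelope f x ≤ C :=
  csSup_le ⟨_, _, convexOn_abs, hf, rfl⟩ (by rintro _ ⟨g, hg, hle, rfl⟩; exact h g hg hle)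

theorem lowerConvexEnvelope_le (hf : ∀ x, |x| ≤ f x) (x : ℝ) : lowerConvexEnvelope f x ≤ f x :=
  lowerConvexEnvelope_le_of_forall hf fun _ _ hle => hle x

theorem convexOn_lowerConvexEnvelope (hf : ∀ x, |x| ≤ f x) :
    ConvexOn ℝ Set.univ (lowerConvexEnvelope f) := by
  refine ⟨convex_univ, fun x _ y _ a b ha hb hab => ?_⟩
  refine lowerConvexEnvelope_le_of_forall hf fun g hg hle => ?_
  refine (hg.2 (Set.mem_univ x) (Set.mem_univ y) ha hb hab).trans ?_
  simp only [smul_eq_mul]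
  exact add_le_add (mul_le_mul_of_nonneg_left (le_lowerConvexEnvelope hg hle x) ha)
    (mul_le_mul_of_nonneg_left (le_lowerConvexEnvelope hg hle y) hb)

/-- A convex function on the line that is at most `|x| + C` grows at slope at most `1`. -/
theorem _root_.ConvexOn.sub_le_of_le_abs_add {h : ℝ → ℝ} (hh : ConvexOn ℝ Set.univ h) {C : ℝ}
    (hle : ∀ x, h x ≤ |x| + C) {x y : ℝ} (hxy : x < y) : h y - h x ≤ y - x := by
  by_contra! hlt
  set d := y - x with hd
  have hd0 : 0 < d := by rw [hd]; linarith
  -- The point `y` is a convex combination of `x` and `y + T`. A slope above 1 on `[x, y]` would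
  -- persist up to `y + T` and exceed `|y + T| + C` for large `T`.
  have key : ∀ T : ℝ, 0 < T → T * (h y - h x - d) ≤ d * (|y| + C - h y) := by
    intro T hT
    have h1 := hh.2 (Set.mem_univ x) (Set.mem_univ (y + T)) 
      (show 0 ≤ T / (T + d) by positivity) (show 0 ≤ d / (T + d) by positivity) (by field_simp)
    have h2 : (T / (T + d)) • x + (d / (T + d)) • (y + T) = y := by
      simp only [smul_eq_mul]
      rw [hd]
      have : T + (y - x) ≠ 0 := by rw [← hd]; positivity
      field_simp
      ring
    rw [h2] at h1
    simp only [smul_eq_mul] at h1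
    have h3 : (T + d) * h y ≤ T * h x + d * h (y + T) := by
      have := mul_le_mul_of_nonneg_left h1 (by positivity : 0 ≤ T + d)
      refine this.trans (le_of_eq ?_)
      field_simp
    have h4 : h (y + T) ≤ |y| + T + C := by
      have := abs_add_le y T
      rw [abs_of_pos hT] at this
      linarith [hle (y + T)]
    nlinarith
  set e := h y - h x - d with he
  have he0 : 0 < e := by rw [he]; linarith
  have hK := key (|d * (|y| + C - h y)| / e + 1) (by positivity)
  have h5 : (|d * (|y| + C - h y)| / e + 1) * e = |d * (|y| + C - h y)| + e := by
    field_simp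
  rw [h5] at hK
  linarith [le_abs_self (d * (|y| + C - h y))]

theorem _root_.ConvexOn.lipschitzWith_one {h : ℝ → ℝ} (hh : ConvexOn ℝ Set.univ h) {C : ℝ}
    (hle : ∀ x, h x ≤ |x| + C) : LipschitzWith 1 h := by
  have hneg : ConvexOn ℝ Set.univ fun x => h (-x) := by
    refine ⟨convex_univ, fun x _ y _ a b ha hb hab => ?_⟩
    have := hh.2 (Set.mem_univ (-x)) (Set.mem_univ (-y)) ha hb hab
    simp only [smul_eq_mul] at this ⊢
    rwa [show -(a * x + b * y) = a * -x + b * -y by ring]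
  have hlen : ∀ x, h (-x) ≤ |x| + C := fun x => by simpa using hle (-x)
  have key : ∀ x y : ℝ, x < y → |h x - h y| ≤ |x - y| := by
    intro x y hxy
    have h1 := hh.sub_le_of_le_abs_add hle hxy
    have h2 := hneg.sub_le_of_le_abs_add hlen (neg_lt_neg hxy)
    simp only [neg_neg] at h2
    rw [abs_sub_comm x y, abs_of_pos (sub_pos.2 hxy)]
    exact abs_le.2 ⟨by linarith, by linarith⟩
  refine LipschitzWith.of_dist_le_mul fun x y => ?_
  rw [NNReal.coe_one, one_mul, Real.dist_eq, Real.dist_eq]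
  rcases lt_trichotomy x y with hxy | rfl | hxy
  · exact key x y hxy
  · simp
  · rw [abs_sub_comm (h x), abs_sub_comm x]
    exact key y x hxy

end Envelope

/-! ### The profile -/

theorem box_height_le_abs (x a b : ℝ) (hx : x = (b - a) / √2) : (a + b) / √2 ≤ |x| + √2 * a ∧
    (a + b) / √2 ≤ |x| + √2 * b := by
  have h2 : 0 < √(2 : ℝ) := by positivity
  have hs : √(2 : ℝ) ^ 2 = 2 := Real.sq_sqrt (by norm_num)
  have ha : (a + b) / √2 = x + √2 * a := by
    rw [hx]; field_simp; rw [hs]; ring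
  have hb : (a + b) / √2 = -x + √2 * b := by
    rw [hx]; field_simp; rw [hs]; ring
  exact ⟨by rw [ha]; linarith [le_abs_self x], by rw [hb]; linarith [neg_abs_le x]⟩

theorem profile_le (lam : n.Partition) {x C : ℝ} (hC : |x| ≤ C)
    (h : ∀ i j : ℕ, j < row lam i → ∀ a ∈ Set.Icc (j : ℝ) (j + 1), ∀ b ∈ Set.Icc (i : ℝ) (i + 1),
      x = (b - a) / √2 → (a + b) / √2 ≤ C) : profile lam x ≤ C := by
  refine csSup_le ⟨|x|, Or.inl rfl⟩ ?_
  rintro y (rfl | ⟨i, j, hij, a, ha, b, hb, hx, rfl⟩)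
  · exact hC
  · exact h i j hij a ha b hb hx

theorem bddAbove_profile (lam : n.Partition) (x : ℝ) :
    |x| + √2 * n ∈ upperBounds ({|x|} ∪ {y : ℝ | ∃ i j : ℕ, j < row lam i ∧
    ∃ a ∈ Set.Icc (j : ℝ) (j + 1), ∃ b ∈ Set.Icc (i : ℝ) (i + 1),
      x = (b - a) / √2 ∧ y = (a + b) / √2}) := by
  rintro y (rfl | ⟨i, j, hij, a, ha, b, hb, hx, rfl⟩)
  · have : 0 ≤ √(2 : ℝ) * n := by positivity
    linarith
  · refine (box_height_le_abs x a b hx).1.trans ?_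
    have h1 : (j : ℝ) + 1 ≤ n := by exact_mod_cast hij.trans_le (row_le lam i)
    have h2 := mul_le_mul_of_nonneg_left (ha.2.trans h1) (Real.sqrt_nonneg 2)
    linarith

theorem profile_le_abs_add (lam : n.Partition) (x : ℝ) : profile lam x ≤ |x| + √2 * n :=
  csSup_le ⟨|x|, Or.inl rfl⟩ (bddAbove_profile lam x)

theorem abs_le_profile (lam : n.Partition) (x : ℝ) : |x| ≤ profile lam x :=
  le_csSup ⟨_, bddAbove_profile lam x⟩ (Or.inl rfl)

theorem le_profile (lam : n.Partition) {i j : ℕ} (hij : j < row lam i) {x a b : ℝ}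
    (ha : a ∈ Set.Icc (j : ℝ) (j + 1)) (hb : b ∈ Set.Icc (i : ℝ) (i + 1))
    (hx : x = (b - a) / √2) : (a + b) / √2 ≤ profile lam x :=
  le_csSup ⟨_, bddAbove_profile lam x⟩ (Or.inr ⟨i, j, hij, a, ha, b, hb, hx, rfl⟩)

/-- The diagram is closed under decreasing either coordinate. A point below the profile has both
unrotated coordinates smaller than those of some diagram point, and their floors name its box. -/
theorem exists_box_of_lt_profile (lam : n.Partition) {x y : ℝ} (hxy : |x| < y)
    (hy : y < profile lam x) : ∃ i j : ℕ, j < row lam i ∧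
      (y - x) / √2 ∈ Set.Icc (j : ℝ) (j + 1) ∧ (y + x) / √2 ∈ Set.Icc (i : ℝ) (i + 1) := by
  have h2 : 0 < √(2 : ℝ) := by positivity
  have hs : √(2 : ℝ) ^ 2 = 2 := Real.sq_sqrt (by norm_num)
  obtain ⟨z, hz, hyz⟩ := exists_lt_of_lt_csSup ⟨|x|, Or.inl rfl⟩ hy
  rcases hz with rfl | ⟨i, j, hij, a, ha, b, hb, hx, rfl⟩
  · exact absurd hyz hxy.not_gt
  have hx1 := (abs_lt.1 hxy).1
  have hx2 := (abs_lt.1 hxy).2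
  have hA0 : 0 ≤ (y - x) / √2 := div_nonneg (by linarith) h2.le
  have hB0 : 0 ≤ (y + x) / √2 := div_nonneg (by linarith) h2.le
  have hA : (y - x) / √2 < a := by
    rw [div_lt_iff₀ h2]
    have : (a + b) / √2 - x = a * √2 := by rw [hx]; field_simp; rw [hs]; ring
    linarith
  have hB : (y + x) / √2 < b := by
    rw [div_lt_iff₀ h2]
    have : (a + b) / √2 + x = b * √2 := by rw [hx]; field_simp; rw [hs]; ring
    linarith
  have hj : ⌊(y - x) / √2⌋₊ ≤ j := Nat.lt_succ_iff.1 ((Nat.floor_lt hA0).2 (by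
    push_cast; linarith [ha.2]))
  have hi : ⌊(y + x) / √2⌋₊ ≤ i := Nat.lt_succ_iff.1 ((Nat.floor_lt hB0).2 (by
    push_cast; linarith [hb.2]))
  exact ⟨_, _, (hj.trans_lt hij).trans_le (row_antitone lam hi),
    ⟨Nat.floor_le hA0, (Nat.lt_floor_add_one _).le⟩,
    ⟨Nat.floor_le hB0, (Nat.lt_floor_add_one _).le⟩⟩

theorem abs_le_scaledProfile (hn : 0 < n) (lam : n.Partition) (x : ℝ) :
    |x| ≤ scaledProfile lam x := by
  have hs : 0 < √(n : ℝ) := Real.sqrt_pos.2 (by exact_mod_cast hn)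
  have := abs_le_profile lam (√(n : ℝ) * x)
  rw [abs_mul, abs_of_pos hs] at this
  rwa [scaledProfile, ← div_eq_inv_mul, le_div_iff₀ hs, mul_comm]

theorem scaledProfile_le_abs_add (hn : 0 < n) (lam : n.Partition) (x : ℝ) :
    scaledProfile lam x ≤ |x| + √2 * √(n : ℝ) := by
  have hs : 0 < √(n : ℝ) := Real.sqrt_pos.2 (by exact_mod_cast hn)
  have hss : √(n : ℝ) * √(n : ℝ) = n := Real.mul_self_sqrt (Nat.cast_nonneg n)
  have := profile_le_abs_add lam (√(n : ℝ) * x)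
  rw [abs_mul, abs_of_pos hs] at this
  rw [scaledProfile, ← div_eq_inv_mul, div_le_iff₀ hs]
  linear_combination this - √2 * hss

/-! ### The area below the profile -/

/-- The Young diagram of `lam` as a region of the plane. -/
def diagramRegion (lam : n.Partition) : Set (ℝ × ℝ) :=
  ⋃ p ∈ (Finset.range n).sigma fun i => Finset.range (row lam i),
    Set.Icc (p.2 : ℝ) (p.2 + 1) ×ˢ Set.Icc (p.1 : ℝ) (p.1 + 1)

theorem volume_diagramRegion_le (lam : n.Partition) : volume (diagramRegion lam) ≤ n := by
  refine (measure_biUnion_finset_le _ _).trans (le_of_eq ?_)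
  have hbox : ∀ p : (_ : ℕ) × ℕ, volume (Set.Icc (p.2 : ℝ) (p.2 + 1) ×ˢ
      Set.Icc (p.1 : ℝ) (p.1 + 1)) = 1 := by
    intro p
    rw [Measure.volume_eq_prod, Measure.prod_prod, Real.volume_Icc, Real.volume_Icc]
    simp
  simp only [hbox, Finset.sum_const, nsmul_eq_mul, mul_one, Finset.card_sigma, Finset.card_range,
    sum_row lam (card_parts_le lam)]

/-- The rotation by `135` degrees followed by scaling by `√n⁻¹`. -/
noncomputable def russianMap (n : ℕ) : ℝ × ℝ →ₗ[ℝ] ℝ × ℝ :=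
  Matrix.toLin (Module.Basis.finTwoProd ℝ) (Module.Basis.finTwoProd ℝ)
    !![-(√2 * √(n : ℝ))⁻¹, (√2 * √(n : ℝ))⁻¹; (√2 * √(n : ℝ))⁻¹, (√2 * √(n : ℝ))⁻¹]

theorem russianMap_apply (n : ℕ) (a b : ℝ) :
    russianMap n (a, b) = ((b - a) / (√2 * √(n : ℝ)), (a + b) / (√2 * √(n : ℝ))) := by
  rw [russianMap, Matrix.toLin_finTwoProd_apply]
  refine Prod.ext ?_ ?_ <;> simp only <;> ring

theorem volume_image_russianMap_le (hn : 0 < n) (lam : n.Partition) :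
    volume (russianMap n '' diagramRegion lam) ≤ 1 := by
  have hn' : (0 : ℝ) < n := by exact_mod_cast hn
  have hdet : LinearMap.det (russianMap n) = -(n : ℝ)⁻¹ := by
    rw [russianMap, LinearMap.det_toLin, Matrix.det_fin_two_of]
    have h1 : (√2 * √(n : ℝ))⁻¹ * (√2 * √(n : ℝ))⁻¹ = (2 * (n : ℝ))⁻¹ := by
      rw [← mul_inv, mul_mul_mul_comm, Real.mul_self_sqrt (by norm_num),
        Real.mul_self_sqrt hn'.le]
    rw [neg_mul, h1]
    field_simp
    norm_num
  rw [Measure.addHaar_image_linearMap, hdet, abs_neg, abs_of_pos (inv_pos.2 hn')]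
  calc ENNReal.ofReal (n : ℝ)⁻¹ * volume (diagramRegion lam)
      ≤ ENNReal.ofReal (n : ℝ)⁻¹ * n := mul_le_mul_right (volume_diagramRegion_le lam) _
    _ = 1 := by
      rw [← ENNReal.ofReal_natCast n, ← ENNReal.ofReal_mul (inv_nonneg.2 hn'.le),
        inv_mul_cancel₀ hn'.ne', ENNReal.ofReal_one]

theorem regionBetween_subset_image (hn : 0 < n) (lam : n.Partition) {h : ℝ → ℝ}
    (hh : ∀ x, h x ≤ scaledProfile lam x) :
    regionBetween (fun x => |x|) h Set.univ ⊆ russianMap n '' diagramRegion lam := by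
  have hs : 0 < √(n : ℝ) := Real.sqrt_pos.2 (by exact_mod_cast hn)
  have h2 : 0 < √(2 : ℝ) := by positivity
  have h22 : √(2 : ℝ) ^ 2 = 2 := Real.sq_sqrt (by norm_num)
  rintro ⟨x, y⟩ ⟨-, hxy, hy⟩
  simp only at hxy hy
  have h1 : |√(n : ℝ) * x| < √(n : ℝ) * y := by
    rw [abs_mul, abs_of_pos hs]
    exact mul_lt_mul_of_pos_left hxy hs
  have h3 : √(n : ℝ) * y < profile lam (√(n : ℝ) * x) := by
    have := hy.trans_le (hh x)
    rwa [scaledProfile, ← div_eq_inv_mul, lt_div_iff₀ hs, mul_comm] at this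
  obtain ⟨i, j, hij, ha, hb⟩ := exists_box_of_lt_profile lam h1 h3
  refine ⟨((√(n : ℝ) * y - √(n : ℝ) * x) / √2, (√(n : ℝ) * y + √(n : ℝ) * x) / √2), ?_, ?_⟩
  · simp only [diagramRegion, Set.mem_iUnion]
    refine ⟨⟨i, j⟩, ?_, ha, hb⟩
    rw [Finset.mem_sigma, Finset.mem_range, Finset.mem_range]
    refine ⟨?_, hij⟩
    by_contra! hni
    rw [row_eq_zero ((card_parts_le lam).trans hni)] at hij
    exact Nat.not_lt_zero _ hij
  · rw [russianMap_apply]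
    refine Prod.ext ?_ ?_
    · simp only
      field_simp
      rw [h22]; ring
    · simp only
      field_simp
      rw [h22]; ring

/-- Convexity together with the bound `|x| + const` forces slopes at most 1. The region above `|x|`
lies in the rotated diagram, scaled to area at most 1. Regularity is needed for the envelope only,
not for the profile. -/
theorem lowerConvexEnvelope_mem_spaceX (hn : 0 < n) (lam : n.Partition) :
    lowerConvexEnvelope (scaledProfile lam) ∈ spaceX := by
  have habs := abs_le_scaledProfile hn lam
  set h := lowerConvexEnvelope (scaledProfile lam) with hh
  have hle : ∀ x, h x ≤ scaledProfile lam x := lowerConvexEnvelope_le habs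
  have hge : ∀ x, |x| ≤ h x := le_lowerConvexEnvelope convexOn_abs habs
  have hlip : LipschitzWith 1 h := (convexOn_lowerConvexEnvelope habs).lipschitzWith_one
    fun x => (hle x).trans (scaledProfile_le_abs_add hn lam x)
  have hcont : Continuous fun x => h x - |x| := hlip.continuous.sub continuous_abs
  have hlint : ∫⁻ x, ENNReal.ofReal (h x - |x|) ≤ 1 := by
    have := volume_regionBetween_eq_lintegral (μ := (volume : Measure ℝ)) (f := fun x => |x|)
      (g := h) (s := Set.univ) continuous_abs.measurable.aemeasurable
      hlip.continuous.measurable.aemeasurable MeasurableSet.univ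
    simp only [Measure.restrict_univ, Pi.sub_apply] at this
    rw [← this, ← Measure.volume_eq_prod]
    exact (measure_mono (regionBetween_subset_image hn lam hle)).trans
      (volume_image_russianMap_le hn lam)
  have hnn : 0 ≤ᵐ[volume] fun x => h x - |x| :=
    Eventually.of_forall fun x => sub_nonneg.2 (hge x)
  refine ⟨hlip, hge, ⟨hcont.aestronglyMeasurable, ?_⟩, ?_⟩
  · rw [hasFiniteIntegral_iff_ofReal hnn]
    exact hlint.trans_lt ENNReal.one_lt_top
  · rw [integral_eq_lintegral_of_nonneg_ae hnn hcont.aestronglyMeasurable]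
    exact ENNReal.toReal_le_of_le_ofReal zero_le_one (by simpa using hlint)

/-! ### Partitions of the optimal shape -/

/-- The Boltzmann parameter of partitions of `n`. -/
noncomputable def invTemp (n : ℕ) : ℝ := √2 * optRate / √(n : ℝ)

theorem invTemp_pos (hn : 0 < n) : 0 < invTemp n := by
  have := optRate_pos
  have hs : 0 < √(n : ℝ) := Real.sqrt_pos.2 (by exact_mod_cast hn)
  unfold invTemp
  positivity

theorem invTemp_sq_mul (hn : 0 < n) : invTemp n ^ 2 * n = Real.pi ^ 2 / 6 := by
  have hn' : (0 : ℝ) < n := by exact_mod_cast hn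
  rw [invTemp, div_pow, mul_pow, Real.sq_sqrt (by norm_num), Real.sq_sqrt hn'.le, optRate_sq]
  field_simp
  norm_num

/-- The two terms of the exponent `t n + π² / (6t)` balance, so `invTemp n` is its minimiser. -/
theorem pi_sq_div_invTemp (hn : 0 < n) : Real.pi ^ 2 / (6 * invTemp n) = invTemp n * n := by
  have h := invTemp_sq_mul hn
  have ht := invTemp_pos hn
  field_simp
  linarith

/-- The rows of the optimal diagram, up to the first row. -/
noncomputable def optRow (n b : ℕ) : ℕ := ⌊ell (invTemp n * ((b : ℝ) + 1)) / invTemp n⌋₊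

theorem optRow_antitone (hn : 0 < n) : Antitone (optRow n) := by
  intro b b' hbb
  have ht := invTemp_pos hn
  refine Nat.floor_le_floor (div_le_div_of_nonneg_right (ell_anti (by positivity) ?_) ht.le)
  have : (b : ℝ) ≤ b' := by exact_mod_cast hbb
  gcongr

theorem sum_optRow_le (hn : 0 < n) (N : ℕ) : ∑ b ∈ Finset.range N, optRow n b ≤ n := by
  have ht := invTemp_pos hn
  have h1 : ((∑ b ∈ Finset.range N, optRow n b : ℕ) : ℝ) ≤
      ∑ b ∈ Finset.range N, ell (invTemp n * ((b : ℝ) + 1)) / invTemp n := by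
    push_cast
    exact Finset.sum_le_sum fun b _ =>
      Nat.floor_le (div_nonneg (ell_nonneg (by positivity)) ht.le)
  rw [← Finset.sum_div] at h1
  have h2 := div_le_div_of_nonneg_right (sum_ell_le ht N) ht.le
  rw [pi_sq_div_invTemp hn, mul_comm, mul_div_assoc, div_self ht.ne', mul_one] at h2
  exact_mod_cast h1.trans h2

theorem optRow_eq_zero (hn : 0 < n) {b : ℕ} (hb : n ≤ b) : optRow n b = 0 := by
  by_contra h
  have h1 : ∑ i ∈ Finset.range (n + 1), 1 ≤ ∑ i ∈ Finset.range (n + 1), optRow n i := by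
    refine Finset.sum_le_sum fun i hi => ?_
    have := optRow_antitone hn (show i ≤ b by have := Finset.mem_range.1 hi; omega)
    omega
  have h2 := sum_optRow_le hn (n + 1)
  simp at h1
  omega

/-- Rounding down loses boxes. The shortage goes into row `0`, where it preserves monotonicity and
does not enter the block count. -/
theorem exists_partition_optRow (hn : 0 < n) : ∃ lam : n.Partition,
    optRow n 0 ≤ row lam 0 ∧ ∀ b, row lam (b + 1) = optRow n (b + 1) := by
  obtain ⟨k, rfl⟩ : ∃ k, n = k + 1 := ⟨n - 1, by omega⟩
  set r := optRow (k + 1) with hr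
  have hanti := optRow_antitone hn
  have hsum : ∑ b ∈ Finset.range (k + 1), r b ≤ k + 1 := sum_optRow_le hn (k + 1)
  have htotal := Finset.sum_range_succ' r k
  set s : ℕ → ℕ := fun b => if b = 0 then r 0 + (k + 1 - ∑ b ∈ Finset.range (k + 1), r b)
    else r b with hs
  have hs0 : s 0 = r 0 + (k + 1 - ∑ b ∈ Finset.range (k + 1), r b) := by simp [hs]
  have hs1 : ∀ b, s (b + 1) = r (b + 1) := fun b => by simp [hs]
  obtain ⟨lam, hlam⟩ := exists_partition_row_eq (n := k + 1) (r := s) (N := k + 1) (by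
      refine antitone_nat_of_succ_le fun b => ?_
      cases b with
      | zero => rw [hs1, hs0]; exact (hanti (Nat.zero_le _)).trans (Nat.le_add_right _ _)
      | succ b => rw [hs1, hs1]; exact hanti (Nat.le_succ _))
    (by
      intro b hb
      obtain ⟨b, rfl⟩ : ∃ c, b = c + 1 := ⟨b - 1, by omega⟩
      rw [hs1]
      exact optRow_eq_zero hn hb)
    (by
      rw [Finset.sum_range_succ', hs0]
      simp only [hs1]
      omega)
  refine ⟨lam, ?_, fun b => ?_⟩
  · rw [hlam, hs0]; exact Nat.le_add_right _ _
  · rw [hlam, hs1]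

theorem le_ell_div_iff {t a b : ℝ} (ht : 0 < t) (hb : 0 < b) :
    a ≤ ell (t * b) / t ↔ 1 ≤ Real.exp (-(t * a)) + Real.exp (-(t * b)) := by
  have hx := one_sub_exp_neg_pos (mul_pos ht hb)
  rw [le_div_iff₀ ht, ell, le_neg, Real.log_le_iff_le_exp hx, mul_comm a t]
  constructor <;> intro h <;> linarith

/-- With `c x = t (b - a) / 2`, the bound is `exp (t (a + b) / 2) ≤ 2 cosh (c x)`. Multiplying by
`exp (-t (a + b) / 2)` gives the symmetric form of the curve. -/
theorem height_le_iff (hn : 0 < n) {x a b : ℝ} (hx : √(n : ℝ) * x = (b - a) / √2) :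
    (a + b) / √2 ≤ √(n : ℝ) * optShape x ↔
      1 ≤ Real.exp (-(invTemp n * a)) + Real.exp (-(invTemp n * b)) := by
  have hc := optRate_pos
  have hs : 0 < √(n : ℝ) := Real.sqrt_pos.2 (by exact_mod_cast hn)
  have h2 : 0 < √(2 : ℝ) := by positivity
  have h22 : √(2 : ℝ) ^ 2 = 2 := Real.sq_sqrt (by norm_num)
  set t := invTemp n with ht
  have hcx : optRate * x = t * (b - a) / 2 := by
    have : x = (b - a) / √2 / √(n : ℝ) := by rw [← hx]; field_simp
    rw [this, ht, invTemp]
    field_simp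
    rw [h22]
  have hh : (a + b) / √2 ≤ √(n : ℝ) * optShape x ↔
      t * (a + b) / 2 ≤ Real.log (Real.exp (optRate * x) + Real.exp (-(optRate * x))) := by
    have : t * (a + b) / 2 = (a + b) / √2 * (optRate / √(n : ℝ)) := by
      rw [ht, invTemp]
      field_simp
      rw [h22]
      ring
    rw [this, optShape, ← mul_div_assoc, le_div_iff₀ hc, ← mul_div_assoc, div_le_iff₀ hs,
      mul_comm (√(n : ℝ))]
  rw [hh, Real.le_log_iff_exp_le (by positivity), hcx,
    ← mul_le_mul_iff_right₀ (Real.exp_pos (-(t * (a + b) / 2))), ← Real.exp_add,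
    mul_add (Real.exp _), ← Real.exp_add, ← Real.exp_add]
  ring_nf
  rw [Real.exp_zero]

theorem profile_le_optShape (hn : 0 < n) {lam : n.Partition}
    (hlam : ∀ b, row lam (b + 1) = optRow n (b + 1)) (x : ℝ) :
    profile lam (√(n : ℝ) * x) ≤ √(n : ℝ) * optShape x + √2 := by
  have ht := invTemp_pos hn
  have h2 : 0 < √(2 : ℝ) := by positivity
  have habs : |√(n : ℝ) * x| ≤ √(n : ℝ) * optShape x := by
    rw [abs_mul, abs_of_nonneg (Real.sqrt_nonneg _)]
    exact mul_le_mul_of_nonneg_left (abs_le_optShape x) (Real.sqrt_nonneg _)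
  refine profile_le lam (by linarith) fun i j hij a ha b hb hx => ?_
  cases i with
  | zero =>
    -- Row `0` may be too long, but its boxes have `b ≤ 1` and rise at most `√2` above `|x|`.
    have := (box_height_le_abs _ a b hx).2
    have hb1 : b ≤ 1 := by simpa using hb.2
    nlinarith
  | succ i =>
    -- The shift by one in `optRow` places the outer corner `(j + 1, i + 2)` of the box under the
    -- curve, hence the whole box.
    rw [hlam, ← Nat.succ_le_iff, optRow, Nat.le_floor_iff
      (div_nonneg (ell_nonneg (by positivity)) ht.le), le_ell_div_iff ht (by positivity)] at hij
    have ha2 := ha.2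
    have hb2 := hb.2
    have h1 : (a + b) / √2 ≤ √(n : ℝ) * optShape x := by
      rw [height_le_iff hn hx]
      refine hij.trans (add_le_add (Real.exp_le_exp.2 ?_) (Real.exp_le_exp.2 ?_))
      · push_cast
        nlinarith
      · nlinarith
    linarith

theorem optShape_le_profile (hn : 0 < n) {lam : n.Partition}
    (hlam : ∀ b, optRow n b ≤ row lam b) (x : ℝ) :
    √(n : ℝ) * optShape x - 2 * √2 ≤ profile lam (√(n : ℝ) * x) := by
  have ht := invTemp_pos hn
  have h2 : 0 < √(2 : ℝ) := by positivity
  have h22 : √(2 : ℝ) ^ 2 = 2 := Real.sq_sqrt (by norm_num)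
  set y := √(n : ℝ) * optShape x with hy
  set a := (y - √(n : ℝ) * x) / √2 with ha
  set b := (y + √(n : ℝ) * x) / √2 with hb
  have hx : √(n : ℝ) * x = (b - a) / √2 := by
    rw [ha, hb]; field_simp; rw [h22]; ring
  have hyab : (a + b) / √2 = y := by
    rw [ha, hb]; field_simp; rw [h22]; ring
  have hexp := (height_le_iff hn hx).1 hyab.le
  have hbox := box_height_le_abs _ a b hx
  have habs := abs_le_profile lam (√(n : ℝ) * x)
  -- Near the axes the target height is already below `|x|`. Elsewhere `(a - 2, b - 2)` lies in a
  -- box of the diagram, and this shift lowers the height by `4 / √2 = 2√2`.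
  rcases lt_or_ge a 2 with ha2 | ha2
  · nlinarith [hbox.1]
  rcases lt_or_ge b 2 with hb2 | hb2
  · nlinarith [hbox.2]
  have hi := Nat.floor_le (show 0 ≤ b - 2 by linarith)
  have hj := Nat.floor_le (show 0 ≤ a - 2 by linarith)
  have hij : ⌊a - 2⌋₊ < row lam ⌊b - 2⌋₊ := by
    refine lt_of_lt_of_le ?_ (hlam _)
    rw [← Nat.succ_le_iff, optRow, Nat.le_floor_iff
      (div_nonneg (ell_nonneg (by positivity)) ht.le), le_ell_div_iff ht (by positivity)]
    refine hexp.trans (add_le_add (Real.exp_le_exp.2 ?_) (Real.exp_le_exp.2 ?_))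
    · push_cast
      nlinarith
    · nlinarith
  have := le_profile lam hij (x := √(n : ℝ) * x) (a := a - 2) (b := b - 2)
    ⟨hj, (Nat.lt_floor_add_one _).le⟩ ⟨hi, (Nat.lt_floor_add_one _).le⟩ (by rw [hx]; ring_nf)
  refine le_trans (le_of_eq ?_) this
  rw [← hyab]
  field_simp
  rw [h22]
  ring

theorem convexOn_optShape : ConvexOn ℝ Set.univ optShape := by
  have hd : deriv optShape = fun x => Real.tanh (optRate * x) :=
    funext fun x => (hasDerivAt_optShape x).deriv
  refine Monotone.convexOn_univ_of_deriv (fun x => (hasDerivAt_optShape x).differentiableAt) ?_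
  rw [hd]
  intro x y hxy
  refine (Real.artanh_le_artanh_iff ⟨Real.neg_one_lt_tanh _, Real.tanh_lt_one _⟩
    ⟨Real.neg_one_lt_tanh _, Real.tanh_lt_one _⟩).1 ?_
  rw [Real.artanh_tanh, Real.artanh_tanh]
  exact mul_le_mul_of_nonneg_left hxy optRate_pos.le

/-- Since `optShape` is convex, a downward translate of it that stays below the profile also stays
below the envelope. -/
theorem abs_envelope_sub_optShape_le (hn : 0 < n) {lam : n.Partition}
    (h0 : optRow n 0 ≤ row lam 0) (hlam : ∀ b, row lam (b + 1) = optRow n (b + 1)) (x : ℝ) :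
    |lowerConvexEnvelope (scaledProfile lam) x - optShape x| ≤ 2 * √2 / √(n : ℝ) := by
  have hs : 0 < √(n : ℝ) := Real.sqrt_pos.2 (by exact_mod_cast hn)
  have h2 : 0 < √(2 : ℝ) := by positivity
  have hlow : ∀ b, optRow n b ≤ row lam b := by
    intro b
    cases b with
    | zero => exact h0
    | succ b => exact (hlam b).ge
  rw [abs_le]
  constructor
  · have hconv : ConvexOn ℝ Set.univ fun z => optShape z + -(2 * √2 / √(n : ℝ)) :=
      convexOn_optShape.add_const _
    have := le_lowerConvexEnvelope (f := scaledProfile lam) hconv (fun z => ?_) x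
    · linarith
    · have h := optShape_le_profile hn hlow z
      rw [scaledProfile, ← div_eq_inv_mul, le_div_iff₀ hs]
      have : (optShape z + -(2 * √2 / √(n : ℝ))) * √(n : ℝ) = √(n : ℝ) * optShape z - 2 * √2 := by
        field_simp
        ring
      linarith
  · have h1 := lowerConvexEnvelope_le (abs_le_scaledProfile hn lam) x
    have h := profile_le_optShape hn hlam x
    have h3 : scaledProfile lam x ≤ optShape x + 2 * √2 / √(n : ℝ) := by
      rw [scaledProfile, ← div_eq_inv_mul, div_le_iff₀ hs]
      have : (optShape x + 2 * √2 / √(n : ℝ)) * √(n : ℝ) = √(n : ℝ) * optShape x + 2 * √2 := by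
        field_simp
      linarith
    linarith

/-! ### Convergence of the functional -/

/-- The derivative of a convex function lies between its left and right secant slopes. These
converge for fixed `y`, and those of `f` approach `deriv f x` as `y → x`. -/
theorem tendsto_deriv_of_convexOn {h : ℕ → ℝ → ℝ} {f : ℝ → ℝ}
    (hconv : ∀ k, ConvexOn ℝ Set.univ (h k)) (hlim : ∀ x, Tendsto (fun k => h k x) atTop (nhds (f x)))
    {x : ℝ} (hd : ∀ k, DifferentiableAt ℝ (h k) x) (hf : DifferentiableAt ℝ f x) :
    Tendsto (fun k => deriv (h k) x) atTop (nhds (deriv f x)) := by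
  have hslope : ∀ y, Tendsto (fun k => slope (h k) x y) atTop (nhds (slope f x y)) := fun y => by
    simp only [slope_def_field]
    exact ((hlim y).sub (hlim x)).div_const _
  have hder := hasDerivAt_iff_tendsto_slope.1 hf.hasDerivAt
  refine tendsto_order.2 ⟨fun a ha => ?_, fun a ha => ?_⟩
  · have h1 := (tendsto_order.1 (hder.mono_left (nhdsWithin_mono x
      (fun y (hy : y < x) => hy.ne) : nhdsWithin x (Set.Iio x) ≤ _))).1 a ha
    obtain ⟨y, hy, hyx⟩ := (h1.and self_mem_nhdsWithin).exists
    filter_upwards [(tendsto_order.1 (hslope y)).1 a hy] with k hk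
    refine hk.trans_le ?_
    rw [slope_comm]
    exact (hconv k).slope_le_deriv (Set.mem_univ y) (Set.mem_univ x) hyx (hd k)
  · have h1 := (tendsto_order.1 (hder.mono_left (nhdsWithin_mono x
      (fun y (hy : x < y) => hy.ne') : nhdsWithin x (Set.Ioi x) ≤ _))).2 a ha
    obtain ⟨y, hy, hyx⟩ := (h1.and self_mem_nhdsWithin).exists
    filter_upwards [(tendsto_order.1 (hslope y)).2 a hy] with k hk
    refine lt_of_le_of_lt ?_ hk
    exact (hconv k).deriv_le_slope (Set.mem_univ x) (Set.mem_univ y) hyx (hd k)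

/-- Fatou's lemma applies because φ is nonnegative and bounds the limit inferior from below. The
maximality of `2 * optRate` gives the other side, so no dominating function is required. -/
theorem tendsto_functionalF {h : ℕ → ℝ → ℝ} (hmem : ∀ k, h k ∈ spaceX)
    (hconv : ∀ k, ConvexOn ℝ Set.univ (h k))
    (hlim : ∀ x, Tendsto (fun k => h k x) atTop (nhds (optShape x))) :
    Tendsto (fun k => functionalF (h k)) atTop (nhds (2 * optRate)) := by
  have hF : ∀ f ∈ spaceX, ∫⁻ x, ENNReal.ofReal (phi (deriv f x)) =
      ENNReal.ofReal (functionalF f) := fun f hf =>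
    (ofReal_integral_eq_lintegral_ofReal (integrable_phi_deriv_and_le hf).1
      (Eventually.of_forall fun x => phi_deriv_nonneg hf.1 x)).symm
  have hae : ∀ᵐ x : ℝ, Tendsto (fun k => ENNReal.ofReal (phi (deriv (h k) x))) atTop
      (nhds (ENNReal.ofReal (phi (deriv optShape x)))) := by
    filter_upwards [ae_all_iff.2 fun k => (hmem k).1.ae_differentiableAt_real] with x hx
    have hphi : ∀ f ∈ spaceX, phi (deriv f x) = Real.binEntropy ((1 + deriv f x) / 2) :=
      fun f hf => phi_eq_binEntropy (abs_deriv_le_one hf.1 x).1 (abs_deriv_le_one hf.1 x).2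
    simp only [fun k => hphi _ (hmem k), hphi _ optShape_mem]
    refine ENNReal.tendsto_ofReal ((Real.binEntropy_continuous.tendsto _).comp ?_)
    exact ((tendsto_deriv_of_convexOn hconv hlim hx
      (hasDerivAt_optShape x).differentiableAt).const_add 1).div_const 2
  have hfatou : ENNReal.ofReal (2 * optRate) ≤
      liminf (fun k => ENNReal.ofReal (functionalF (h k))) atTop := by
    have := lintegral_liminf_le (μ := (volume : Measure ℝ)) (u := atTop)
      (f := fun k x => ENNReal.ofReal (phi (deriv (h k) x)))
      fun k => (measurable_phi_deriv (hmem k).1).ennreal_ofReal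
    simp only [hF _ (hmem _)] at this
    rw [← functionalF_optShape, ← hF _ optShape_mem]
    refine le_trans (le_of_eq (lintegral_congr_ae ?_)) this
    filter_upwards [hae] with x hx
    exact hx.liminf_eq.symm
  refine tendsto_order.2 ⟨fun a ha => ?_, fun a ha => Eventually.of_forall fun k =>
    (integrable_phi_deriv_and_le (hmem k)).2.trans_lt ha⟩
  have hlt : ENNReal.ofReal a < ENNReal.ofReal (2 * optRate) :=
    (ENNReal.ofReal_lt_ofReal_iff (by linarith [optRate_pos])).2 ha
  filter_upwards [eventually_lt_of_lt_liminf (hlt.trans_le hfatou)] with k hk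
  exact lt_of_not_ge fun hge => hk.not_ge (ENNReal.ofReal_le_ofReal hge)

/-! ### Binomial coefficients -/

theorem mul_log_succ_sub_log_le (n : ℕ) :
    (n : ℝ) * (Real.log ((n : ℝ) + 1) - Real.log n) ≤ 1 := by
  rcases Nat.eq_zero_or_pos n with rfl | hn
  · simp
  have hn' : (0 : ℝ) < n := by exact_mod_cast hn
  rw [← Real.log_div (by positivity) hn'.ne']
  have h := Real.log_le_sub_one_of_pos (by positivity : 0 < ((n : ℝ) + 1) / n)
  have h2 : ((n : ℝ) + 1) / n - 1 = 1 / n := by field_simp; ring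
  rw [h2] at h
  calc (n : ℝ) * Real.log (((n : ℝ) + 1) / n) ≤ n * (1 / n) := by gcongr
    _ = 1 := by field_simp

theorem le_log_factorial (n : ℕ) : (n : ℝ) * Real.log n - n ≤ Real.log n.factorial := by
  induction n with
  | zero => simp
  | succ n ih =>
    rw [Nat.factorial_succ, Nat.cast_mul, Real.log_mul (by positivity) (by positivity)]
    have := mul_log_succ_sub_log_le n
    push_cast
    linarith

theorem log_factorial_le (n : ℕ) :
    Real.log n.factorial ≤ ((n : ℝ) + 1) * Real.log ((n : ℝ) + 1) - n := by
  induction n with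
  | zero => simp
  | succ n ih =>
    rw [Nat.factorial_succ, Nat.cast_mul, Real.log_mul (by positivity) (by positivity)]
    have h : 1 ≤ ((n : ℝ) + 2) * (Real.log ((n : ℝ) + 2) - Real.log ((n : ℝ) + 1)) := by
      rw [← Real.log_div (by positivity) (by positivity)]
      have h := Real.one_sub_inv_le_log_of_pos (by positivity : 0 < ((n : ℝ) + 2) / (n + 1))
      have h2 : 1 - (((n : ℝ) + 2) / (n + 1))⁻¹ = 1 / (n + 2) := by field_simp; ring
      rw [h2] at h
      calc (1 : ℝ) = (n + 2) * (1 / (n + 2)) := by field_simp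
        _ ≤ _ := by gcongr
    push_cast
    have e : (n : ℝ) + 1 + 1 = n + 2 := by ring
    rw [e]
    linarith

/-- Elementary Stirling bounds. Passing from `(k + 1) log (k + 1)` to `k log k` costs `1 + log (k +
1)` for each factorial in the denominator. -/
theorem le_log_choose (L D : ℕ) :
    ((L : ℝ) + D) * Real.log ((L : ℝ) + D) - L * Real.log L - D * Real.log D ≤
      Real.log ((L + D).choose L) + 2 + Real.log ((L : ℝ) + 1) + Real.log ((D : ℝ) + 1) := by
  have hchoose : Real.log ((L + D).choose L) =
      Real.log (L + D).factorial - Real.log L.factorial - Real.log D.factorial := by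
    have h := Nat.add_choose_mul_factorial_mul_factorial L D
    rw [← Nat.choose_symm_add] at h
    have h' : (((L + D).choose L : ℕ) : ℝ) * L.factorial * D.factorial = (L + D).factorial := by
      exact_mod_cast h
    have hpos : (0 : ℝ) < (L + D).choose L := by
      exact_mod_cast Nat.choose_pos (Nat.le_add_right L D)
    rw [← h', Real.log_mul (by positivity) (by positivity),
      Real.log_mul hpos.ne' (by positivity)]
    ring
  have h1 := le_log_factorial (L + D)
  have h2 := log_factorial_le L
  have h3 := log_factorial_le D
  have h4 := mul_log_succ_sub_log_le L
  have h5 := mul_log_succ_sub_log_le D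
  push_cast at h1
  rw [hchoose]
  linarith

/-- The entropy of a binomial coefficient is bounded below by its Legendre dual. -/
theorem le_log_choose_of_forall_le {L D : ℕ} (hL : 0 < L) {δ V : ℝ} (hδ : δ ≤ D + 1)
    (hV : ∀ θ, 0 < θ → V ≤ L * ell θ + δ * θ) :
    V ≤ Real.log ((L + D).choose L) + 3 + 2 * Real.log ((L : ℝ) + 1) +
      Real.log ((D : ℝ) + 1) := by
  have hL' : (1 : ℝ) ≤ L := by exact_mod_cast hL
  have hlogL : 0 < Real.log ((L : ℝ) + 1) := Real.log_pos (by linarith)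
  -- The critical point of `L * ell θ + u * θ` is `θ = log ((L + u) / u)`. For `D = 0` it does not
  -- exist, and `u = 1` is used instead.
  have hell : ∀ u : ℝ, 0 < u → ell (Real.log ((L + u) / u)) = Real.log ((L + u) / L) := by
    intro u hu
    have h1 : 0 < (L + u) / u := by positivity
    have h2 : 1 - ((L + u) / u)⁻¹ = L / (L + u) := by field_simp; ring
    rw [ell, Real.exp_neg, Real.exp_log h1, h2, ← Real.log_inv, inv_div]
  rcases Nat.eq_zero_or_pos D with rfl | hD
  · have h := hV (Real.log ((L + 1) / 1)) (by rwa [div_one])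
    rw [hell 1 one_pos, div_one, Real.log_div (by positivity) (by positivity)] at h
    have h2 := mul_log_succ_sub_log_le L
    simp only [Nat.cast_zero, zero_add] at hδ
    simp
    nlinarith
  · have hD' : (1 : ℝ) ≤ D := by exact_mod_cast hD
    have hθ : 0 < Real.log ((L + D) / D) := Real.log_pos (by
      rw [lt_div_iff₀ (by positivity)]; linarith)
    have hθle : Real.log ((L + D) / D) ≤ Real.log ((L : ℝ) + 1) := by
      refine Real.log_le_log (by positivity) ?_
      rw [div_le_iff₀ (by positivity)]
      nlinarith
    have h := hV _ hθ
    rw [hell D (by positivity)] at h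
    have h2 := le_log_choose L D
    -- Since `δ` exceeds `D` by at most one, the excess costs one extra `θ ≤ log (L + 1)`.
    have h3 : δ * Real.log ((L + D) / D) ≤ (D + 1) * Real.log ((L + D) / D) := by gcongr
    have h4 : (L : ℝ) * Real.log ((L + D) / L) + D * Real.log ((L + D) / D) =
        ((L : ℝ) + D) * Real.log ((L : ℝ) + D) - L * Real.log L - D * Real.log D := by
      rw [Real.log_div (by positivity) (by positivity), Real.log_div (by positivity) (by positivity)]
      ring
    linarith

/-! ### The number of subpartitions of the optimal diagram -/

/-- Outside `[s, s']` the convex function `ell` lies above the chord through `s` and `s'`. Inside,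
`ell θ ≥ ell s'` and `θ ≥ s` suffice. -/
theorem ell_tangent {s s' c θ : ℝ} (hs : 0 < s) (hss : s < s') (hc : 0 < c) (hθ : 0 < θ) :
    c * (s' - s) * ell s' + c * (ell s - ell s') * s ≤
      c * (s' - s) * ell θ + c * (ell s - ell s') * θ := by
  have hanti := ell_anti hs hss.le
  suffices (s' - s) * ell s' + (ell s - ell s') * s ≤ (s' - s) * ell θ + (ell s - ell s') * θ by
    nlinarith
  have hs' : 0 < s' := hs.trans hss
  rcases lt_or_ge θ s with h1 | h1
  · have h := convexOn_ell.slope_mono_adjacent (Set.mem_Ioi.2 hθ) (Set.mem_Ioi.2 hs') h1 hss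
    rw [div_le_div_iff₀ (by linarith) (by linarith)] at h
    nlinarith
  rcases le_or_gt θ s' with h2 | h2
  · have := ell_anti hθ h2
    nlinarith
  · have h := convexOn_ell.slope_mono_adjacent (Set.mem_Ioi.2 hs) (Set.mem_Ioi.2 hθ) hss h2
    rw [div_le_div_iff₀ (by linarith) (by linarith)] at h
    nlinarith

/-- The scaled position of the `i`-th block of `L` rows. -/
noncomputable def gridPoint (n L i : ℕ) : ℝ := invTemp n * ((L : ℝ) * (i + 1) + 1)

theorem gridPoint_pos (hn : 0 < n) (L i : ℕ) : 0 < gridPoint n L i := by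
  have := invTemp_pos hn
  unfold gridPoint
  positivity

theorem gridPoint_succ_sub (n L i : ℕ) :
    gridPoint n L (i + 1) - gridPoint n L i = invTemp n * L := by
  simp only [gridPoint]; push_cast; ring

/-- Each block contributes its dual entropy bound. Abel summation of `(ell (s i) - ell (s (i + 1)))
* s i` produces a second copy of `∑ t L ell (s (i + 1))`, whence the factor 2, and this sum
dominates the integral because `ell` decreases. -/
theorem log_numSubpartitions_ge (hn : 0 < n) {lam : n.Partition}
    (hlam : ∀ b, row lam (b + 1) = optRow n (b + 1)) {L : ℕ} (hL : 0 < L) (hLn : L ≤ n) (B : ℕ) :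
    2 * (∫ y in gridPoint n L 1..gridPoint n L (B + 1), ell y) -
      gridPoint n L B * ell (gridPoint n L B) -
      invTemp n * B * (3 + 3 * Real.log ((n : ℝ) + 1)) ≤
    invTemp n * Real.log (numSubpartitions lam) := by
  set t := invTemp n with ht_def
  have ht : 0 < t := invTemp_pos hn
  set s := gridPoint n L with hs_def
  have hs : ∀ i, 0 < s i := gridPoint_pos hn L
  have hstep : ∀ i, s (i + 1) - s i = t * L := gridPoint_succ_sub n L
  have hL' : (0 : ℝ) < L := by exact_mod_cast hL
  have hlt : ∀ i, s i < s (i + 1) := fun i => by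
    have := hstep i
    have : 0 < t * L := by positivity
    linarith
  set D : ℕ → ℕ := fun i => row lam (L * (i + 1)) - row lam (L * (i + 2)) with hD
  have hrow : ∀ i, row lam (L * (i + 1)) = ⌊ell (s i) / t⌋₊ := by
    intro i
    obtain ⟨b, hb⟩ : ∃ b, L * (i + 1) = b + 1 :=
      ⟨L * (i + 1) - 1, by
        have : 0 < L * (i + 1) := Nat.mul_pos hL (Nat.succ_pos i)
        omega⟩
    rw [hb, hlam, ← hb, optRow, hs_def, gridPoint]
    push_cast
    rfl
  -- Two floors are subtracted, so the drop of the curve exceeds the integer drop by at most one.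
  have hδ : ∀ i, (ell (s i) - ell (s (i + 1))) / t ≤ D i + 1 := by
    intro i
    have h1 := Nat.lt_floor_add_one (ell (s i) / t)
    have h2 := Nat.floor_le (div_nonneg (ell_nonneg (hs (i + 1))) ht.le)
    have h3 : ((row lam (L * (i + 1)) : ℕ) : ℝ) ≤ D i + row lam (L * (i + 2)) := by
      have : row lam (L * (i + 1)) ≤ D i + row lam (L * (i + 2)) := by simp only [hD]; omega
      exact_mod_cast this
    rw [hrow i, show i + 2 = (i + 1) + 1 from rfl, hrow (i + 1)] at h3
    rw [sub_div]
    linarith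
  have hDn : ∀ i, (D i : ℝ) ≤ n := fun i => by
    have : D i ≤ n := (Nat.sub_le _ _).trans (row_le _ _)
    exact_mod_cast this
  have hblock : ∀ i, L * ell (s (i + 1)) + (ell (s i) - ell (s (i + 1))) / t * s i -
      (3 + 3 * Real.log ((n : ℝ) + 1)) ≤ Real.log ((L + D i).choose L) := by
    intro i
    have h := le_log_choose_of_forall_le hL (hδ i)
      (V := L * ell (s (i + 1)) + (ell (s i) - ell (s (i + 1))) / t * s i) (fun θ hθ => by
        have h := ell_tangent (hs i) (hlt i) (inv_pos.2 ht) hθ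
        rw [hstep i, inv_mul_cancel_left₀ ht.ne'] at h
        simpa only [div_eq_inv_mul] using h)
    have h1 : Real.log ((L : ℝ) + 1) ≤ Real.log ((n : ℝ) + 1) :=
      Real.log_le_log (by positivity) (by
        have : (L : ℝ) ≤ n := by exact_mod_cast hLn
        linarith)
    have h2 : Real.log ((D i : ℝ) + 1) ≤ Real.log ((n : ℝ) + 1) :=
      Real.log_le_log (by positivity) (by linarith [hDn i])
    linarith
  have hlog : ∑ i ∈ Finset.range B, Real.log ((L + D i).choose L) ≤
      Real.log (numSubpartitions lam) := by
    have hpos : ∀ i, (0 : ℝ) < (L + D i).choose L := fun i => by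
      exact_mod_cast Nat.choose_pos (Nat.le_add_right L (D i))
    rw [← Real.log_prod fun i _ => (hpos i).ne']
    refine Real.log_le_log (Finset.prod_pos fun i _ => hpos i) ?_
    exact_mod_cast prod_choose_le_numSubpartitions lam hL B
  have hsum := (Finset.sum_le_sum fun i (_ : i ∈ Finset.range B) => hblock i).trans hlog
  have hterm : ∀ i, t * (L * ell (s (i + 1)) + (ell (s i) - ell (s (i + 1))) / t * s i -
      (3 + 3 * Real.log ((n : ℝ) + 1))) = 2 * (t * L * ell (s (i + 1))) -
      (s (i + 1) * ell (s (i + 1)) - s i * ell (s i)) -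
      t * (3 + 3 * Real.log ((n : ℝ) + 1)) := by
    intro i
    have : t * ((ell (s i) - ell (s (i + 1))) / t * s i) = (ell (s i) - ell (s (i + 1))) * s i := by
      field_simp
    linear_combination this + ell (s (i + 1)) * hstep i
  have hsum' := mul_le_mul_of_nonneg_left hsum ht.le
  rw [Finset.mul_sum, Finset.sum_congr rfl fun i _ => hterm i, Finset.sum_sub_distrib,
    Finset.sum_sub_distrib, Finset.sum_range_sub (fun i => s i * ell (s i)), ← Finset.mul_sum,
    Finset.sum_const, Finset.card_range, nsmul_eq_mul] at hsum'
  have hint : ∀ i, IntervalIntegrable ell volume (s (i + 1)) (s (i + 2)) := fun i => by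
    refine ContinuousOn.intervalIntegrable (continuousOn_ell.mono fun y hy => ?_)
    rw [Set.uIcc_of_le (hlt (i + 1)).le] at hy
    exact (hs _).trans_le hy.1
  have hriem : (∫ y in s 1..s (B + 1), ell y) ≤
      ∑ i ∈ Finset.range B, t * L * ell (s (i + 1)) := by
    have := intervalIntegral.sum_integral_adjacent_intervals (f := ell) (μ := volume)
      (a := fun i => s (i + 1)) (n := B) fun i _ => hint i
    rw [zero_add] at this
    rw [← this]
    refine Finset.sum_le_sum fun i _ => ?_
    have h := intervalIntegral.integral_mono_on (hlt (i + 1)).le (hint i)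
      (intervalIntegrable_const (c := ell (s (i + 1)))) fun y hy => ell_anti (hs _) hy.1
    rwa [intervalIntegral.integral_const, hstep, smul_eq_mul] at h
  have h0 : 0 ≤ s 0 * ell (s 0) := mul_nonneg (hs 0).le (ell_nonneg (hs 0))
  linarith

/-! ### Asymptotics -/

theorem tendsto_intervalIntegral_ell {a b : ℕ → ℝ}
    (ha : Tendsto a atTop (nhds 0)) (hb : Tendsto b atTop atTop) (hapos : ∀ᶠ i in atTop, 0 < a i) :
    Tendsto (fun i => ∫ y in a i..b i, ell y) atTop (nhds (Real.pi ^ 2 / 6)) := by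
  -- Cutting `ell` off at zero makes it integrable on the whole line, so that its primitive is
  -- continuous at `0` despite the singularity there.
  set g : ℝ → ℝ := (Set.Ioi 0).indicator ell with hg
  have hgint : Integrable g := (integrable_indicator_iff measurableSet_Ioi).2 integrableOn_ell
  have hgi : ∀ x y, IntervalIntegrable g volume x y := fun x y => hgint.intervalIntegrable
  have h1 : Tendsto (fun i => ∫ y in (0 : ℝ)..b i, g y) atTop (nhds (Real.pi ^ 2 / 6)) := by
    rw [← integral_ell, ← setIntegral_congr_fun (f := g) measurableSet_Ioi
      fun y hy => Set.indicator_of_mem hy ell]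
    exact intervalIntegral_tendsto_integral_Ioi 0 hgint.integrableOn hb
  have h2 : Tendsto (fun i => ∫ y in (0 : ℝ)..a i, g y) atTop (nhds 0) := by
    have := ((intervalIntegral.continuous_primitive hgi 0).tendsto 0).comp ha
    rwa [intervalIntegral.integral_same] at this
  have h3 := h1.sub h2
  rw [sub_zero] at h3
  refine h3.congr' ?_
  filter_upwards [hapos, hb.eventually_gt_atTop 0] with i hai hbi
  rw [intervalIntegral.integral_interval_sub_left (hgi _ _) (hgi _ _)]
  refine intervalIntegral.integral_congr fun y hy => Set.indicator_of_mem ?_ ell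
  exact (lt_min hai hbi).trans_le hy.1

theorem eventually_floor_rpow_bounds {p : ℝ} (hp : 0 < p) : ∀ᶠ n : ℕ in atTop,
    (n : ℝ) ^ p / 2 ≤ (⌊(n : ℝ) ^ p⌋₊ : ℝ) ∧ (⌊(n : ℝ) ^ p⌋₊ : ℝ) ≤ (n : ℝ) ^ p := by
  filter_upwards [eventually_ge_atTop 1] with n hn
  have hn' : (1 : ℝ) ≤ n := by exact_mod_cast hn
  have h1 := Real.one_le_rpow hn' hp.le
  have h2 := Nat.lt_floor_add_one ((n : ℝ) ^ p)
  have h3 : (1 : ℝ) ≤ ⌊(n : ℝ) ^ p⌋₊ := by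
    exact_mod_cast Nat.le_floor (show ((1 : ℕ) : ℝ) ≤ _ by simpa using h1)
  exact ⟨by linarith, Nat.floor_le (by positivity)⟩

theorem invTemp_eq_rpow (n : ℕ) : invTemp n = √2 * optRate * (n : ℝ) ^ (-(1 / 2) : ℝ) := by
  rw [invTemp, Real.sqrt_eq_rpow (n : ℝ), Real.rpow_neg (Nat.cast_nonneg n), div_eq_mul_inv]

theorem tendsto_natCast_rpow_neg {p : ℝ} (hp : 0 < p) :
    Tendsto (fun n : ℕ => (n : ℝ) ^ (-p)) atTop (nhds 0) :=
  (tendsto_rpow_neg_atTop hp).comp tendsto_natCast_atTop_atTop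

/-- The height of the blocks in the lower bound. -/
noncomputable def blockHeight (n : ℕ) : ℕ := ⌊(n : ℝ) ^ (1 / 4 : ℝ)⌋₊

/-- The number of the blocks in the lower bound. -/
noncomputable def blockCount (n : ℕ) : ℕ := ⌊(n : ℝ) ^ (3 / 8 : ℝ)⌋₊

/-- The exponents must satisfy three conditions against the scale `n^{1/2}`: one block is negligible
(`1/4 < 1/2`), all blocks together exhaust the shape (`1/4 + 3/8 > 1/2`), and one logarithm per
block is negligible (`3/8 < 1/2`). -/
theorem tendsto_gridPoint_one :
    Tendsto (fun n => gridPoint n (blockHeight n) 1) atTop (nhds 0) := by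
  have hc := optRate_pos
  have h := (tendsto_natCast_rpow_neg (p := 1 / 4) (by norm_num)).const_mul (√2 * optRate * 3)
  rw [mul_zero] at h
  refine squeeze_zero' ?_ ?_ h
  · filter_upwards [eventually_gt_atTop 0] with n hn
    exact (gridPoint_pos hn _ _).le
  · filter_upwards [eventually_ge_atTop 1,
      eventually_floor_rpow_bounds (p := 1 / 4) (by norm_num)] with n hn hL
    have hn' : (1 : ℝ) ≤ n := by exact_mod_cast hn
    have h1 := Real.one_le_rpow hn' (show (0 : ℝ) ≤ 1 / 4 by norm_num)
    rw [gridPoint, invTemp_eq_rpow, blockHeight,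
      show (-(1 / 4) : ℝ) = -(1 / 2) + 1 / 4 by norm_num, Real.rpow_add (by positivity)]
    calc √2 * optRate * (n : ℝ) ^ (-(1 / 2) : ℝ) *
          ((⌊(n : ℝ) ^ (1 / 4 : ℝ)⌋₊ : ℝ) * ((1 : ℕ) + 1) + 1)
        ≤ √2 * optRate * (n : ℝ) ^ (-(1 / 2) : ℝ) * (3 * (n : ℝ) ^ (1 / 4 : ℝ)) := by
          gcongr
          push_cast
          linarith [hL.2]
      _ = _ := by ring

theorem tendsto_gridPoint_blockCount :
    Tendsto (fun n => gridPoint n (blockHeight n) (blockCount n)) atTop atTop := by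
  have hc := optRate_pos
  have h : Tendsto (fun n : ℕ => √2 * optRate / 4 * (n : ℝ) ^ (1 / 8 : ℝ)) atTop atTop :=
    ((tendsto_rpow_atTop (by norm_num)).comp tendsto_natCast_atTop_atTop).const_mul_atTop
      (by positivity)
  refine tendsto_atTop_mono' _ ?_ h
  filter_upwards [eventually_ge_atTop 1, eventually_floor_rpow_bounds (p := 1 / 4) (by norm_num),
    eventually_floor_rpow_bounds (p := 3 / 8) (by norm_num)] with n hn hL hB
  have hn' : (0 : ℝ) < n := by exact_mod_cast hn
  rw [gridPoint, invTemp_eq_rpow, blockHeight, blockCount,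
    show (1 / 8 : ℝ) = -(1 / 2) + (1 / 4 + 3 / 8) by norm_num, Real.rpow_add hn',
    Real.rpow_add hn']
  calc √2 * optRate / 4 * ((n : ℝ) ^ (-(1 / 2) : ℝ) * ((n : ℝ) ^ (1 / 4 : ℝ) * (n : ℝ) ^ (3 / 8 : ℝ)))
      = √2 * optRate * (n : ℝ) ^ (-(1 / 2) : ℝ) *
          ((n : ℝ) ^ (1 / 4 : ℝ) / 2 * ((n : ℝ) ^ (3 / 8 : ℝ) / 2 + 0) + 0) := by ring
    _ ≤ _ := by
      gcongr
      · exact hL.1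
      · exact hB.1
      · exact zero_le_one
      · exact zero_le_one

theorem tendsto_block_error : Tendsto (fun n => invTemp n * blockCount n *
    (3 + 3 * Real.log ((n : ℝ) + 1))) atTop (nhds 0) := by
  have hc := optRate_pos
  have h := (tendsto_natCast_rpow_neg (p := 1 / 16) (by norm_num)).const_mul (√2 * optRate * 99)
  rw [mul_zero] at h
  refine squeeze_zero' ?_ ?_ h
  · filter_upwards [eventually_gt_atTop 0] with n hn
    have := invTemp_pos hn
    have : 0 ≤ Real.log ((n : ℝ) + 1) := Real.log_nonneg (by linarith [n.cast_nonneg (α := ℝ)])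
    positivity
  · filter_upwards [eventually_ge_atTop 1,
      eventually_floor_rpow_bounds (p := 3 / 8) (by norm_num)] with n hn hB
    have hn' : (1 : ℝ) ≤ n := by exact_mod_cast hn
    have h1 := Real.one_le_rpow hn' (show (0 : ℝ) ≤ 1 / 16 by norm_num)
    have h2 : Real.log ((n : ℝ) + 1) ≤ 32 * (n : ℝ) ^ (1 / 16 : ℝ) := by
      have h3 := Real.log_le_rpow_div (x := (n : ℝ) + 1) (by positivity)
        (show (0 : ℝ) < 1 / 16 by norm_num)
      have h4 : ((n : ℝ) + 1) ^ (1 / 16 : ℝ) ≤ (2 * (n : ℝ)) ^ (1 / 16 : ℝ) :=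
        Real.rpow_le_rpow (by positivity) (by linarith) (by norm_num)
      rw [Real.mul_rpow (by norm_num) (by positivity)] at h4
      have h5 : (2 : ℝ) ^ (1 / 16 : ℝ) ≤ 2 := by
        conv_rhs => rw [← Real.rpow_one 2]
        exact Real.rpow_le_rpow_of_exponent_le (by norm_num) (by norm_num)
      have h6 := mul_le_mul_of_nonneg_right h5 (zero_le_one.trans h1)
      linarith
    have hlog : 0 ≤ Real.log ((n : ℝ) + 1) := Real.log_nonneg (by linarith)
    rw [invTemp_eq_rpow, blockCount,
      show (-(1 / 16) : ℝ) = -(1 / 2) + (3 / 8 + 1 / 16) by norm_num,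
      Real.rpow_add (by positivity), Real.rpow_add (by positivity)]
    calc √2 * optRate * (n : ℝ) ^ (-(1 / 2) : ℝ) * (⌊(n : ℝ) ^ (3 / 8 : ℝ)⌋₊ : ℝ) *
          (3 + 3 * Real.log ((n : ℝ) + 1))
        ≤ √2 * optRate * (n : ℝ) ^ (-(1 / 2) : ℝ) * (n : ℝ) ^ (3 / 8 : ℝ) *
          (99 * (n : ℝ) ^ (1 / 16 : ℝ)) := by
          gcongr
          · exact hB.2
          · linarith
      _ = _ := by ring

theorem numSubpartitions_pos {n : ℕ} (lam : n.Partition) : 0 < numSubpartitions lam :=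
  (Set.ncard_pos (finite_subpartitions lam)).2 ⟨⟨n, lam⟩, le_rfl, fun _ _ => le_rfl⟩

theorem tendsto_log_numSubpartitions_div_sqrt {mu : (n : ℕ) → n.Partition}
    (hmu : ∀ n, 0 < n → ∀ b, row (mu n) (b + 1) = optRow n (b + 1)) :
    Tendsto (fun n => Real.log (numSubpartitions (mu n)) / √(n : ℝ)) atTop
      (nhds (√2 * (2 * optRate))) := by
  have hc := optRate_pos
  have h22 : √(2 : ℝ) ^ 2 = 2 := Real.sq_sqrt (by norm_num)
  have hpos : ∀ᶠ n : ℕ in atTop, 0 < gridPoint n (blockHeight n) 1 := by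
    filter_upwards [eventually_gt_atTop 0] with n hn
    exact gridPoint_pos hn _ _
  have hB := tendsto_gridPoint_blockCount
  have hB1 : Tendsto (fun n => gridPoint n (blockHeight n) (blockCount n + 1)) atTop atTop := by
    refine tendsto_atTop_mono' _ ?_ hB
    filter_upwards [eventually_gt_atTop 0] with n hn
    have h1 := gridPoint_succ_sub n (blockHeight n) (blockCount n)
    have h2 := invTemp_pos hn
    have h3 : 0 ≤ invTemp n * blockHeight n := by positivity
    linarith
  have hlow := ((((tendsto_intervalIntegral_ell tendsto_gridPoint_one hB1 hpos).const_mul 2).sub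
    (tendsto_mul_ell_atTop.comp hB)).sub tendsto_block_error).div_const (√2 * optRate)
  -- The lower limit `2 ζ(2) / (√2 c)` equals the upper constant `2√2 c` precisely because `c² = π²
  -- / 12`.
  have hval : (2 * (Real.pi ^ 2 / 6) - 0 - 0) / (√2 * optRate) = √2 * (2 * optRate) := by
    have := optRate_sq
    rw [div_eq_iff (by positivity)]
    linear_combination (-2 * optRate ^ 2) * h22 - 4 * this
  rw [hval] at hlow
  refine tendsto_of_tendsto_of_tendsto_of_le_of_le' hlow tendsto_const_nhds ?_ ?_
  · filter_upwards [eventually_ge_atTop 1] with n hn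
    have hn' : (1 : ℝ) ≤ n := by exact_mod_cast hn
    have hL : 0 < blockHeight n := Nat.floor_pos.2 (Real.one_le_rpow hn' (by norm_num))
    have hLn : blockHeight n ≤ n := by
      refine Nat.floor_le_of_le ?_
      conv_rhs => rw [← Real.rpow_one (n : ℝ)]
      exact Real.rpow_le_rpow_of_exponent_le hn' (by norm_num)
    have h := log_numSubpartitions_ge hn (hmu n hn) hL hLn (blockCount n)
    rw [div_le_iff₀ (by positivity)]
    refine h.trans (le_of_eq ?_)
    rw [invTemp]
    field_simp
  · filter_upwards [eventually_ge_atTop 1] with n hn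
    have hn' : (0 : ℝ) < n := by exact_mod_cast hn
    have hs : 0 < √(n : ℝ) := Real.sqrt_pos.2 hn'
    have h := numSubpartitions_le_exp (mu n) (invTemp_pos hn)
    have hs0 : (0 : ℝ) < numSubpartitions (mu n) := by exact_mod_cast numSubpartitions_pos (mu n)
    rw [pi_sq_div_invTemp hn, ← Real.log_le_iff_le_exp hs0] at h
    rw [div_le_iff₀ hs]
    refine h.trans (le_of_eq ?_)
    have hss : √(n : ℝ) ^ 2 = n := Real.sq_sqrt hn'.le
    rw [invTemp]
    field_simp
    linear_combination (-2 : ℝ) * hss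

theorem tendsto_functionalF_envelope {mu : (n : ℕ) → n.Partition}
    (hmu0 : ∀ n, 0 < n → optRow n 0 ≤ row (mu n) 0)
    (hmu : ∀ n, 0 < n → ∀ b, row (mu n) (b + 1) = optRow n (b + 1)) :
    Tendsto (fun n => functionalF (lowerConvexEnvelope (scaledProfile (mu n)))) atTop
      (nhds (2 * optRate)) := by
  -- Scaling by `√n` degenerates at `n = 0`, so the sequence is started at `1`.
  rw [← tendsto_add_atTop_iff_nat 1]
  refine tendsto_functionalF (fun k => lowerConvexEnvelope_mem_spaceX k.succ_pos _)
    (fun k => convexOn_lowerConvexEnvelope (abs_le_scaledProfile k.succ_pos _)) fun x => ?_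
  rw [tendsto_iff_norm_sub_tendsto_zero]
  refine squeeze_zero (fun k => norm_nonneg _) (fun k =>
    abs_envelope_sub_optShape_le k.succ_pos (hmu0 _ k.succ_pos) (hmu _ k.succ_pos) x) ?_
  exact (tendsto_const_nhds.div_atTop (Real.tendsto_sqrt_atTop.comp
    (tendsto_natCast_atTop_atTop.comp (tendsto_add_atTop_nat 1))))

/-- The error is defined as the exact difference of exponents, so the identity holds for every `n`,
including `0`, and only its growth needs the limits. -/
theorem exists_error_term {s F : ℕ → ℝ} {M : ℝ} (hs : ∀ n, 0 < s n)
    (hlog : Tendsto (fun n => Real.log (s n) / √(n : ℝ)) atTop (nhds (√2 * M)))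
    (hF : Tendsto F atTop (nhds M)) :
    ∃ ε : ℕ → ℝ, ε =o[atTop] (fun n : ℕ => √(n : ℝ)) ∧
      ∀ n : ℕ, s n = Real.exp (√(2 * (n : ℝ)) * F n - ε n) := by
  refine ⟨fun n => √(2 * (n : ℝ)) * F n - Real.log (s n), ?_, fun n => ?_⟩
  · have hne : ∀ᶠ n : ℕ in atTop, √(n : ℝ) ≠ 0 := by
      filter_upwards [eventually_gt_atTop 0] with n hn
      exact (Real.sqrt_pos.2 (by exact_mod_cast hn)).ne'
    rw [isLittleO_iff_tendsto' (hne.mono fun n h h0 => absurd h0 h)]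
    have h := (hF.const_mul √2).sub hlog
    rw [sub_self] at h
    refine h.congr' ?_
    filter_upwards [hne] with n hn
    rw [Real.sqrt_mul (by norm_num)]
    field_simp
  · rw [sub_sub_cancel, Real.exp_log (hs n)]

end SubpartitionGrowth

open SubpartitionGrowth in
theorem proposition4p1 :
    (∀ f ∈ spaceX, Integrable (fun x : ℝ => phi (deriv f x))) ∧
    ∃ M : ℝ, IsGreatest (functionalF '' spaceX) M ∧
      ∃ mu : (n : ℕ) → n.Partition,
        (∃ ε : ℕ → ℝ, ε =o[atTop] (fun n : ℕ => √(n : ℝ)) ∧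
          ∀ n : ℕ, (numSubpartitions (mu n) : ℝ) = Real.exp (√(2 * (n : ℝ)) * M - ε n)) ∧
        (∃ ε : ℕ → ℝ, ε =o[atTop] (fun n : ℕ => √(n : ℝ)) ∧
          ∀ n : ℕ, (numSubpartitions (mu n) : ℝ) =
            Real.exp (√(2 * (n : ℝ)) *
              functionalF (lowerConvexEnvelope (scaledProfile (mu n))) - ε n)) := by
  refine ⟨fun f hf => (integrable_phi_deriv_and_le hf).1, 2 * optRate, isGreatest_functionalF, ?_⟩
  have hex : ∀ n : ℕ, ∃ lam : n.Partition, 0 < n →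
      optRow n 0 ≤ row lam 0 ∧ ∀ b, row lam (b + 1) = optRow n (b + 1) := fun n => by
    rcases Nat.eq_zero_or_pos n with rfl | hn
    · exact ⟨default, fun h => absurd h (lt_irrefl 0)⟩
    · obtain ⟨lam, hlam⟩ := exists_partition_optRow hn
      exact ⟨lam, fun _ => hlam⟩
  choose mu hmu using hex
  have hpos : ∀ n, (0 : ℝ) < numSubpartitions (mu n) := fun n => by
    exact_mod_cast numSubpartitions_pos (mu n)
  have hlog := tendsto_log_numSubpartitions_div_sqrt fun n hn => (hmu n hn).2
  exact ⟨mu, exists_error_term hpos hlog tendsto_const_nhds, exists_error_term hpos hlog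
    (tendsto_functionalF_envelope (fun n hn => (hmu n hn).1) fun n hn => (hmu n hn).2)⟩
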